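/- Let $1<p<\infty$, $\gamma<0$ and $\omega>\gamma^2/4$, and let $$\varphi_{\omega,\gamma}(x)=\Bigl[\tfrac{(p+1)\omega}{2}\,\mathrm{sech}^2\Bigl(\tfrac{(p-1)\sqrt\omega}{2}|x|+\tanh^{-1}\bigl(\tfrac{\gamma}{2\sqrt\omega}\bigr)\Bigr)\Bigr]^{\frac1{p-1}},\qquad x\in\mathbb R,$$ which is the positive $H^1(\mathbb R)$ solution of $-\varphi''+\omega\varphi-\gamma\delta\varphi-|\varphi|^{p-1}\varphi=0$, where $\delta$ is the Dirac distribution at $0$. For $c\in\{p,1\}$ consider on $H^1(\mathbb R,\mathbb R)$ the bilinear form $$B_c(v,z)=\int_{\mathbb R}v'z'\,dx+\omega\int_{\mathbb R}vz\,dx-\gamma v(0)z(0)-\int_{\mathbb R}c\,\varphi_{\omega,\gamma}^{p-1}vz\,dx,$$ and the associated unbounded operator on $L^2(\mathbb R,\mathbb R)$: its domain is the set of $v\in H^1(\mathbb R,\mathbb R)$ for which there is a (necessarily unique) $w\in L^2(\mathbb R,\mathbb R)$ with $B_c(v,z)=\int_{\mathbb R} wz\,dx$ for all $z\in H^1(\mathbb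 R,\mathbb R)$, and it maps $v$ to $w$. Denote it by $L_1=-\partial_x^2+\omega-\gamma\delta-p\varphi_{\omega,\gamma}^{p-1}$ when $c=p$ and by $L_2=-\partial_x^2+\omega-\gamma\delta-\varphi_{\omega,\gamma}^{p-1}$ when $c=1$. Let $H$ be the real-linear operator $Hu=L_1(\mathrm{Re}\,u)+iL_2(\mathrm{Im}\,u)$ on $L^2(\mathbb R,\mathbb C)$, with domain $\{u:\mathrm{Re}\,u\in D(L_1),\ \mathrm{Im}\,u\in D(L_2)\}$. Then: 1. $L_1$ has exactly two negative eigenvalues, and each of them is simple (its eigenspace has real dimension one); 2. $H$ has exactly two negative eigenvalues, and each of them is simple (its eigenspace has real dimension one). In particular, the number of negative eigenvalues is $n(L_1)=n(H)=2$, whether or not multiplicities are counted. -/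

import Mathlib

open MeasureTheory Set
open scoped BoundedContinuousFunction

noncomputable section

namespace DeltaNLS

/-- The real Hilbert space `L²(ℝ, ℝ)`. -/
abbrev L2R : Type := Lp ℝ 2 (volume : Measure ℝ)

/-- The space `L²(ℝ, ℂ)`, used below as a real vector space. -/
abbrev L2C : Type := Lp ℂ 2 (volume : Measure ℝ)

/-! ### The standing wave profile -/

/-- The profile
`φ(x) = [((p+1)ω/2) sech²(((p-1)√ω/2)|x| + artanh(γ/(2√ω)))]^{1/(p-1)}`. -/
def phi (p ω γ x : ℝ) : ℝ :=
  ((p + 1) * ω / 2 *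
    (1 / Real.cosh ((p - 1) * √ω / 2 * |x| + Real.artanh (γ / (2 * √ω)))) ^ 2) ^ (1 / (p - 1))

lemma continuous_phi {p : ℝ} (hp : 1 < p) (ω γ : ℝ) : Continuous (phi p ω γ) := by
  unfold phi
  refine Continuous.rpow_const ?_ (fun x => Or.inr (by
    have : 0 < p - 1 := by linarith
    positivity))
  refine continuous_const.mul (Continuous.pow (Continuous.div continuous_const ?_ ?_) 2)
  · exact Real.continuous_cosh.comp (by fun_prop)
  · exact fun x => (Real.cosh_pos _).ne'

lemma abs_phi_le {p : ℝ} (hp : 1 < p) (ω γ x : ℝ) :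
    |phi p ω γ x| ≤ |(p + 1) * ω / 2| ^ (1 / (p - 1)) := by
  have hp' : 0 < p - 1 := by linarith
  unfold phi
  refine (Real.abs_rpow_le_abs_rpow _ _).trans ?_
  refine Real.rpow_le_rpow (abs_nonneg _) ?_ (by positivity)
  rw [abs_mul]
  refine mul_le_of_le_one_right (abs_nonneg _) ?_
  rw [abs_of_nonneg (by positivity)]
  refine pow_le_one₀ (by positivity) ?_
  rw [div_le_one (Real.cosh_pos _)]
  exact Real.one_le_cosh _

/-- The bounded continuous potential `c φ^{p-1}`. -/
def potential (c : ℝ) {p : ℝ} (hp : 1 < p) (ω γ : ℝ) : ℝ →ᵇ ℝ :=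
  BoundedContinuousFunction.ofNormedAddCommGroup
    (fun x => c * phi p ω γ x ^ (p - 1))
    (continuous_const.mul ((continuous_phi hp ω γ).rpow_const
      (fun _ => Or.inr (by linarith))))
    (|c| * (|(p + 1) * ω / 2| ^ (1 / (p - 1))) ^ (p - 1))
    (fun x => by
      rw [Real.norm_eq_abs, abs_mul]
      refine mul_le_mul_of_nonneg_left ?_ (abs_nonneg _)
      refine (Real.abs_rpow_le_abs_rpow _ _).trans ?_
      exact Real.rpow_le_rpow (abs_nonneg _) (abs_phi_le hp ω γ x) (by linarith))

/-! ### The Sobolev space `H¹(ℝ, ℝ)` -/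

/-- `IsH1 v v'` : the function `v` is the continuous representative of an element of `H¹(ℝ, ℝ)`,
and `v' ∈ L²` is (a representative of) its weak derivative. -/
structure IsH1 (v v' : ℝ → ℝ) : Prop where
  continuous : Continuous v
  memLp : MemLp v 2 volume
  memLp_deriv : MemLp v' 2 volume
  weak_deriv : ∀ ψ : ℝ → ℝ, ContDiff ℝ (⊤ : ℕ∞) ψ → HasCompactSupport ψ →
    ∫ x, v x * deriv ψ x = - ∫ x, v' x * ψ x

lemma integrable_mul_of_memLp {f g : ℝ → ℝ} (hf : MemLp f 2 volume) (hg : MemLp g 2 volume) :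
    Integrable (fun x => f x * g x) :=
  MemLp.integrable_mul (p := 2) (q := 2) hf hg

lemma memLp_of_test {ψ : ℝ → ℝ} (h : Continuous ψ) (hc : HasCompactSupport ψ) :
    MemLp ψ 2 volume := h.memLp_of_hasCompactSupport hc

lemma IsH1.zero : IsH1 0 0 where
  continuous := continuous_const
  memLp := MemLp.zero
  memLp_deriv := MemLp.zero
  weak_deriv := by simp

lemma IsH1.add {f f' g g' : ℝ → ℝ} (hf : IsH1 f f') (hg : IsH1 g g') :
    IsH1 (f + g) (f' + g') where
  continuous := hf.continuous.add hg.continuous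
  memLp := hf.memLp.add hg.memLp
  memLp_deriv := hf.memLp_deriv.add hg.memLp_deriv
  weak_deriv := fun ψ h hc => by
    have h1 : MemLp ψ 2 volume := memLp_of_test h.continuous hc
    have h2 : MemLp (deriv ψ) 2 volume :=
      memLp_of_test (h.continuous_deriv (by simp)) hc.deriv
    simp only [Pi.add_apply, add_mul]
    rw [integral_add (integrable_mul_of_memLp hf.memLp h2)
        (integrable_mul_of_memLp hg.memLp h2),
      integral_add (integrable_mul_of_memLp hf.memLp_deriv h1)
        (integrable_mul_of_memLp hg.memLp_deriv h1),
      hf.weak_deriv ψ h hc, hg.weak_deriv ψ h hc]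
    ring

lemma IsH1.smul {f f' : ℝ → ℝ} (c : ℝ) (hf : IsH1 f f') : IsH1 (c • f) (c • f') where
  continuous := hf.continuous.const_smul c
  memLp := hf.memLp.const_smul c
  memLp_deriv := hf.memLp_deriv.const_smul c
  weak_deriv := fun ψ h hc => by
    simp only [Pi.smul_apply, smul_eq_mul, mul_assoc, integral_const_mul]
    rw [hf.weak_deriv ψ h hc]
    ring

/-- Test functions belong to `H¹`. -/
lemma IsH1.of_test {ψ : ℝ → ℝ} (h : ContDiff ℝ (⊤ : ℕ∞) ψ) (hc : HasCompactSupport ψ) :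
    IsH1 ψ (deriv ψ) where
  continuous := h.continuous
  memLp := memLp_of_test h.continuous hc
  memLp_deriv := memLp_of_test (h.continuous_deriv (by simp)) hc.deriv
  weak_deriv := fun χ k kc => by
    have a1 := memLp_of_test h.continuous hc
    have a2 := memLp_of_test (h.continuous_deriv (by simp)) hc.deriv
    have b1 := memLp_of_test k.continuous kc
    have b2 := memLp_of_test (k.continuous_deriv (by simp)) kc.deriv
    exact integral_mul_deriv_eq_deriv_mul_of_integrable
      (fun x _ => (h.differentiable (by simp) x).hasDerivAt)
      (fun x _ => (k.differentiable (by simp) x).hasDerivAt)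
      (integrable_mul_of_memLp a1 b2) (integrable_mul_of_memLp a2 b1)
      (integrable_mul_of_memLp a1 b1)

/-! ### The quadratic forms and the operators they define -/

/-- The bilinear form
`B(v,z) = ∫ v'z' + ω ∫ vz - γ v(0)z(0) - ∫ V v z` on `H¹(ℝ, ℝ)`. -/
def bilinForm (ω γ : ℝ) (V : ℝ → ℝ) (v v' z z' : ℝ → ℝ) : ℝ :=
  (∫ x, v' x * z' x) + ω * (∫ x, v x * z x) - γ * (v 0 * z 0) - ∫ x, V x * v x * z x

lemma integrable_potential_mul (V : ℝ →ᵇ ℝ) {f g : ℝ → ℝ} (hf : MemLp f 2 volume)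
    (hg : MemLp g 2 volume) : Integrable (fun x => V x * f x * g x) := by
  simp only [mul_assoc]
  exact (integrable_mul_of_memLp hf hg).bdd_mul (c := ‖V‖)
    V.continuous.aestronglyMeasurable (Filter.Eventually.of_forall V.norm_coe_le_norm)

/-- The graph of the operator defined by the form: the pairs `(v, w) ∈ L² × L²` with `v ∈ H¹`
and `B(v,z) = (w,z)` for every `z ∈ H¹`. -/
def formGraph (ω γ : ℝ) (V : ℝ →ᵇ ℝ) : Submodule ℝ (L2R × L2R) where
  carrier := {q | ∃ v v' : ℝ → ℝ, IsH1 v v' ∧ v =ᵐ[volume] q.1 ∧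
    ∀ z z' : ℝ → ℝ, IsH1 z z' → bilinForm ω γ V v v' z z' = ∫ x, q.2 x * z x}
  zero_mem' := by
    refine ⟨0, 0, IsH1.zero, (Lp.coeFn_zero ℝ 2 volume).symm, fun z z' _ => ?_⟩
    simp [bilinForm]
  add_mem' := by
    rintro ⟨a, b⟩ ⟨c, d⟩ ⟨f, f', hf, hfa, hfb⟩ ⟨g, g', hg, hgc, hgd⟩
    refine ⟨f + g, f' + g', hf.add hg, (hfa.add hgc).trans (Lp.coeFn_add a c).symm,
      fun z z' hz => ?_⟩
    have key : ∫ x, (b + d : L2R) x * z x = (∫ x, b x * z x) + ∫ x, d x * z x := by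
      rw [← integral_add (integrable_mul_of_memLp (Lp.memLp b) hz.memLp)
        (integrable_mul_of_memLp (Lp.memLp d) hz.memLp)]
      refine integral_congr_ae ?_
      filter_upwards [Lp.coeFn_add b d] with x hx
      rw [hx, Pi.add_apply, add_mul]
    change _ = ∫ x, (b + d : L2R) x * z x
    rw [key, ← hfb z z' hz, ← hgd z z' hz]
    simp only [bilinForm, Pi.add_apply, add_mul, mul_add]
    rw [integral_add (integrable_mul_of_memLp hf.memLp_deriv hz.memLp_deriv)
        (integrable_mul_of_memLp hg.memLp_deriv hz.memLp_deriv),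
      integral_add (integrable_mul_of_memLp hf.memLp hz.memLp)
        (integrable_mul_of_memLp hg.memLp hz.memLp),
      integral_add (integrable_potential_mul V hf.memLp hz.memLp)
        (integrable_potential_mul V hg.memLp hz.memLp)]
    ring
  smul_mem' := by
    rintro r ⟨a, b⟩ ⟨f, f', hf, hfa, hfb⟩
    refine ⟨r • f, r • f', hf.smul r, (hfa.const_smul r).trans (Lp.coeFn_smul r a).symm,
      fun z z' hz => ?_⟩
    have key : ∫ x, (r • b : L2R) x * z x = r * ∫ x, b x * z x := by
      rw [← integral_const_mul]
      refine integral_congr_ae ?_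
      filter_upwards [Lp.coeFn_smul r b] with x hx
      simp [hx, mul_assoc]
    change _ = ∫ x, (r • b : L2R) x * z x
    rw [key, ← hfb z z' hz]
    have e1 : ∀ x, (r • f') x * z' x = r * (f' x * z' x) := fun x => by simp [mul_assoc]
    have e2 : ∀ x, (r • f) x * z x = r * (f x * z x) := fun x => by simp [mul_assoc]
    have e3 : ∀ x, V x * (r • f) x * z x = r * (V x * f x * z x) := fun x => by
      simp only [Pi.smul_apply, smul_eq_mul]; ring
    simp only [bilinForm, e1, e2, e3, integral_const_mul]
    ring

/-- The `w` in the definition of the graph is determined by `v`. -/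
theorem formGraph_single_valued (ω γ : ℝ) (V : ℝ →ᵇ ℝ) (q : L2R × L2R)
    (hq : q ∈ formGraph ω γ V) (h0 : q.1 = 0) : q.2 = 0 := by
  obtain ⟨v, v', hv, hvq, h⟩ := hq
  have hv0 : v = 0 := by
    refine (Continuous.ae_eq_iff_eq (volume : Measure ℝ) hv.continuous continuous_const).1 ?_
    rw [h0] at hvq
    exact hvq.trans (Lp.coeFn_zero ℝ 2 volume)
  subst hv0
  have hv'0 : v' =ᵐ[volume] 0 := by
    refine ae_eq_zero_of_integral_contDiff_smul_eq_zero
      (hv.memLp_deriv.locallyIntegrable (by norm_num)) fun ψ hψ hc => ?_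
    have := hv.weak_deriv ψ hψ hc
    simp only [Pi.zero_apply, zero_mul, integral_zero] at this
    simp only [smul_eq_mul, mul_comm (ψ _)]
    linarith
  have hw : (q.2 : ℝ → ℝ) =ᵐ[volume] 0 := by
    refine ae_eq_zero_of_integral_contDiff_smul_eq_zero
      ((Lp.memLp q.2).locallyIntegrable (by norm_num)) fun ψ hψ hc => ?_
    have := h ψ (deriv ψ) (IsH1.of_test hψ hc)
    have hz : ∫ x, v' x * deriv ψ x = 0 := by
      rw [← integral_zero ℝ ℝ]
      refine integral_congr_ae ?_
      filter_upwards [hv'0] with x hx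
      simp [hx]
    simp only [bilinForm, hz, Pi.zero_apply, zero_mul, mul_zero, integral_zero] at this
    simp only [smul_eq_mul, mul_comm (ψ _)]
    linarith
  exact (Lp.eq_zero_iff_ae_eq_zero).2 hw

/-- The unbounded operator on `L²(ℝ, ℝ)` defined by the form `B`: its domain consists of the
`v ∈ H¹` for which there is `w ∈ L²` with `B(v,z) = (w,z)` for all `z ∈ H¹`, and `v ↦ w`. -/
def formOperator (ω γ : ℝ) (V : ℝ →ᵇ ℝ) : L2R →ₗ.[ℝ] L2R := (formGraph ω γ V).toLinearPMap

theorem formOperator_graph (ω γ : ℝ) (V : ℝ →ᵇ ℝ) :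
    (formOperator ω γ V).graph = formGraph ω γ V :=
  Submodule.toLinearPMap_graph_eq _ (formGraph_single_valued ω γ V)

/-- `L₁ = -∂ₓ² + ω - γδ - p φ^{p-1}` on `L²(ℝ, ℝ)`. -/
def L1 {p : ℝ} (hp : 1 < p) (ω γ : ℝ) : L2R →ₗ.[ℝ] L2R :=
  formOperator ω γ (potential p hp ω γ)

/-- `L₂ = -∂ₓ² + ω - γδ - φ^{p-1}` on `L²(ℝ, ℝ)`. -/
def L2 {p : ℝ} (hp : 1 < p) (ω γ : ℝ) : L2R →ₗ.[ℝ] L2R :=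
  formOperator ω γ (potential 1 hp ω γ)

/-- Real part `L²(ℝ, ℂ) → L²(ℝ, ℝ)`. -/
def reL : L2C →ₗ[ℝ] L2R := (Complex.reCLM.compLpL 2 volume).toLinearMap

/-- Imaginary part `L²(ℝ, ℂ) → L²(ℝ, ℝ)`. -/
def imL : L2C →ₗ[ℝ] L2R := (Complex.imCLM.compLpL 2 volume).toLinearMap

/-- The map `u₁ ↦ u₁` from `L²(ℝ, ℝ)` to `L²(ℝ, ℂ)`. -/
def ofRealL : L2R →ₗ[ℝ] L2C := (Complex.ofRealCLM.compLpL 2 volume).toLinearMap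

/-- The map `u₂ ↦ i u₂` from `L²(ℝ, ℝ)` to `L²(ℝ, ℂ)`. -/
def ofImL : L2R →ₗ[ℝ] L2C :=
  ((Complex.I • Complex.ofRealCLM : ℝ →L[ℝ] ℂ).compLpL 2 volume).toLinearMap

/-- The real-linear operator `H u = L₁ (Re u) + i L₂ (Im u)` on `L²(ℝ, ℂ)`, with domain the
`u` such that `Re u ∈ D(L₁)` and `Im u ∈ D(L₂)`. -/
def H {p : ℝ} (hp : 1 < p) (ω γ : ℝ) : L2C →ₗ.[ℝ] L2C where
  domain := (L1 hp ω γ).domain.comap reL ⊓ (L2 hp ω γ).domain.comap imL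
  toFun :=
    ofRealL ∘ₗ (L1 hp ω γ).toFun ∘ₗ
        (reL.restrict (p := (L1 hp ω γ).domain.comap reL ⊓ (L2 hp ω γ).domain.comap imL)
          (q := (L1 hp ω γ).domain) (fun _ hu => hu.1)) +
      ofImL ∘ₗ (L2 hp ω γ).toFun ∘ₗ
        (imL.restrict (p := (L1 hp ω γ).domain.comap reL ⊓ (L2 hp ω γ).domain.comap imL)
          (q := (L2 hp ω γ).domain) (fun _ hu => hu.2))

/-! ### Negative eigenvalues -/

section Eigen

variable {E : Type*} [AddCommGroup E] [Module ℝ E]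

/-- The eigenspace `{x ∈ D(T) : T x = μ x}` of an unbounded operator `T`. -/
def eigenspace (T : E →ₗ.[ℝ] E) (μ : ℝ) : Submodule ℝ E where
  carrier := {x | ∃ h : x ∈ T.domain, T ⟨x, h⟩ = μ • x}
  zero_mem' := ⟨T.domain.zero_mem, by
    have : (⟨0, T.domain.zero_mem⟩ : T.domain) = 0 := rfl
    rw [this, LinearPMap.map_zero, smul_zero]⟩
  add_mem' := by
    rintro x y ⟨hx, ex⟩ ⟨hy, ey⟩
    refine ⟨T.domain.add_mem hx hy, ?_⟩
    have : (⟨x + y, T.domain.add_mem hx hy⟩ : T.domain) = ⟨x, hx⟩ + ⟨y, hy⟩ := rfl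
    rw [this, LinearPMap.map_add, ex, ey, smul_add]
  smul_mem' := by
    rintro c x ⟨hx, ex⟩
    refine ⟨T.domain.smul_mem c hx, ?_⟩
    have : (⟨c • x, T.domain.smul_mem c hx⟩ : T.domain) = c • ⟨x, hx⟩ := rfl
    rw [this, LinearPMap.map_smul, ex, smul_comm]

/-- The set of negative eigenvalues of `T`. -/
def negEigenvalues (T : E →ₗ.[ℝ] E) : Set ℝ := {μ | μ < 0 ∧ eigenspace T μ ≠ ⊥}

end Eigen

end DeltaNLS

end

open MeasureTheory Set
open scoped BoundedContinuousFunction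

noncomputable section

namespace DeltaNLS

open Filter Topology

/-! Put a = (p-1)√ω/2, b = artanh(γ/(2√ω)) < 0 and N = (p+1)/(p-1) > 1. Then ω = a²(N-1)², γ =
2a(N-1) tanh b, and both potentials are Pöschl–Teller wells a²((N-1)² - M sech²(a|x|+b)), with M =
N(N+1) for `L1` and M = N(N-1) for `L2`.

Lower bounds come from Jacobi's method: if r' + r² = Q, then v'² + Qv² - (rv²)' = (v' - rv)² ≥ 0.
For `L2`, taking r = φ'/φ shows that the form is nonnegative (`energy_nonneg_of_ground`). For `L1`,
r = φ''/φ' has poles at ±b/a, so the form is nonnegative on functions vanishing at these two points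
(`energy_nonneg_of_nodes`). Two linear conditions leave room for at most two negative eigenvalues
(`eigenspace_eq_bot_of_nodes`).

Two are exhibited. The decaying solution on the half line with energy ω - a²κ² is cosh^(-κ) times a
hypergeometric function of (1 - tanh)/2. Its odd extension is an eigenfunction when it vanishes at
b, and its even extension when it satisfies a Robin condition at b. The intermediate value theorem
in κ gives a root of the first in (N-1, N) and of the second beyond N (`exists_jost_eq_zero`,
`exists_jost_robin`).

Simplicity is one-dimensional: the Wronskian of two square integrable solutions is constant and
integrable on a half line, hence zero (`IsDeltaSol.exists_eq_smul`). Since `L2` has no negative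
eigenvalue, the negative eigenspaces of `H` are the images of those of `L1`. -/

/-! ### Weak derivatives and primitives on the line -/

theorem exists_ae_eq_const_of_integral_mul_deriv_eq_zero {f : ℝ → ℝ}
    (hf : LocallyIntegrable f volume)
    (h : ∀ ψ : ℝ → ℝ, ContDiff ℝ (⊤ : ℕ∞) ψ → HasCompactSupport ψ → ∫ x, f x * deriv ψ x = 0) :
    ∃ c : ℝ, f =ᵐ[volume] fun _ => c := by
  let β : ContDiffBump (0 : ℝ) := ⟨1, 2, one_pos, one_lt_two⟩
  let ρ : ℝ → ℝ := β.normed volume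
  have hρ : ContDiff ℝ (⊤ : ℕ∞) ρ := β.contDiff_normed
  have hρc : HasCompactSupport ρ := β.hasCompactSupport_normed
  have hρ1 : ∫ x, ρ x = 1 := β.integral_normed
  refine ⟨∫ x, f x * ρ x, ?_⟩
  refine ae_eq_of_integral_contDiff_smul_eq hf (locallyIntegrable_const _) fun χ hχ hχc => ?_
  set m := ∫ x, χ x with hm
  -- Since ρ has mass one, η has mean zero, so its primitive taken from the left of its support is
  -- again a test function.
  let η : ℝ → ℝ := fun x => χ x - m * ρ x
  have hη : ContDiff ℝ (⊤ : ℕ∞) η := hχ.sub (contDiff_const.mul hρ)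
  have hηc : HasCompactSupport η := hχc.sub (hρc.mul_left)
  have iχ : Integrable χ := hχ.continuous.integrable_of_hasCompactSupport hχc
  have iρ : Integrable ρ := hρ.continuous.integrable_of_hasCompactSupport hρc
  have iη : Integrable η := hη.continuous.integrable_of_hasCompactSupport hηc
  have hη0 : ∫ x, η x = 0 := by
    simp only [η]
    rw [integral_sub iχ (iρ.const_mul m), integral_const_mul, hρ1, ← hm]
    ring
  obtain ⟨R, hR⟩ : ∃ R : ℝ, ∀ x, R < |x| → η x = 0 := by
    obtain ⟨R, hR⟩ := hηc.isCompact.isBounded.subset_closedBall 0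
    refine ⟨R, fun x hx => ?_⟩
    by_contra hne
    have := hR (subset_tsupport _ (Function.mem_support.2 hne))
    rw [mem_closedBall_zero_iff, Real.norm_eq_abs] at this
    linarith
  let ψ : ℝ → ℝ := fun x => ∫ t in (-(|R| + 1))..x, η t
  have hψd : ∀ x, HasDerivAt ψ (η x) x := fun x =>
    intervalIntegral.integral_hasDerivAt_right (hη.continuous.intervalIntegrable _ _)
      hη.continuous.stronglyMeasurable.stronglyMeasurableAtFilter hη.continuous.continuousAt
  have hψ' : deriv ψ = η := funext fun x => (hψd x).deriv
  have hψ : ContDiff ℝ (⊤ : ℕ∞) ψ :=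
    contDiff_infty_iff_deriv.2 ⟨fun x => (hψd x).differentiableAt, by rw [hψ']; exact hη⟩
  have hψc : HasCompactSupport ψ := by
    refine HasCompactSupport.intro (isCompact_Icc (a := -(|R| + 1)) (b := |R| + 1)) fun x hx => ?_
    have hRR := le_abs_self R
    rcases lt_or_ge x (-(|R| + 1)) with h1 | h1
    · refine intervalIntegral.integral_zero_ae (ae_of_all _ fun t ht => hR t ?_)
      rw [uIoc_of_ge h1.le] at ht
      have : |R| + 1 ≤ |t| := by
        rw [le_abs]; right; linarith [ht.2]
      linarith
    · have h2 : |R| + 1 < x := by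
        by_contra hcon
        exact hx ⟨h1, not_lt.1 hcon⟩
      have : ∫ t, η t = ∫ t in (-(|R| + 1))..x, η t := by
        refine (intervalIntegral.integral_eq_integral_of_support_subset fun t ht => ?_).symm
        by_contra hcon
        refine ht (hR t ?_)
        by_contra hle
        have := abs_le.1 (not_lt.1 hle)
        exact hcon ⟨by linarith, by linarith⟩
      change ∫ t in (-(|R| + 1))..x, η t = 0
      rw [← this, hη0]
  have key := h ψ hψ hψc
  rw [hψ'] at key
  have fχ : Integrable (fun x => f x * χ x) := by
    simpa only [smul_eq_mul, mul_comm] using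
      hf.integrable_smul_left_of_hasCompactSupport hχ.continuous hχc
  have fρ : Integrable (fun x => f x * ρ x) := by
    simpa only [smul_eq_mul, mul_comm] using
      hf.integrable_smul_left_of_hasCompactSupport hρ.continuous hρc
  have e : ∀ x, f x * η x = f x * χ x - m * (f x * ρ x) := fun x => by simp only [η]; ring
  simp only [e] at key
  rw [integral_sub fχ (fρ.const_mul m), integral_const_mul] at key
  simp only [smul_eq_mul, integral_mul_const, mul_comm (χ _) (f _)]
  linarith

/-- A primitive of a locally integrable function is absolutely continuous, and Lebesgue
differentiation identifies its derivative with z' almost everywhere. -/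
theorem intervalIntegral_mul_deriv_eq_of_primitive {g g' z z' : ℝ → ℝ}
    (hg : ∀ x, HasDerivAt g (g' x) x) (hg' : Continuous g')
    (hz' : LocallyIntegrable z' volume) (hz : ∀ x y, z y - z x = ∫ t in x..y, z' t) (a b : ℝ) :
    ∫ x in a..b, g x * z' x = g b * z b - g a * z a - ∫ x in a..b, g' x * z x := by
  have hzi : ∀ x y : ℝ, IntervalIntegrable z' volume x y := fun x y =>
    intervalIntegrable_iff.mpr <|
      (hz'.integrableOn_isCompact isCompact_uIcc).mono_set uIoc_subset_uIcc
  have hze : z = fun x => z a + ∫ t in a..x, z' t := funext fun x => by rw [← hz]; ring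
  have hzac : AbsolutelyContinuousOnInterval z a b := by
    have h1 := (hzi a b).absolutelyContinuousOnInterval_intervalIntegral (c := a) (by simp)
    have h2 : AbsolutelyContinuousOnInterval (fun _ : ℝ => z a) a b :=
      ContDiffOn.absolutelyContinuousOnInterval contDiffOn_const
    rw [hze]
    exact h2.add h1
  have hgd : deriv g = g' := funext fun x => (hg x).deriv
  have hgc : ContDiff ℝ 1 g :=
    contDiff_one_iff_deriv.2 ⟨fun x => (hg x).differentiableAt, by rw [hgd]; exact hg'⟩
  have hgac : AbsolutelyContinuousOnInterval g a b := hgc.contDiffOn.absolutelyContinuousOnInterval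
  have := hgac.integral_mul_deriv_eq_deriv_mul hzac
  rw [hgd] at this
  rw [← this]
  refine intervalIntegral.integral_congr_ae ?_
  filter_upwards [_root_.LocallyIntegrable.ae_hasDerivAt_integral hz'] with x hx _
  have : HasDerivAt z (z' x) x := by
    rw [hze]
    exact (hx a).const_add _
  rw [this.deriv]

theorem exists_Icc_support {ψ : ℝ → ℝ} (hc : HasCompactSupport ψ) :
    ∃ R : ℝ, 0 < R ∧ ∀ x, R ≤ |x| → ψ x = 0 ∧ deriv ψ x = 0 := by
  obtain ⟨R, hR⟩ := hc.isCompact.isBounded.subset_closedBall 0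
  refine ⟨|R| + 1, by positivity, fun x hx => ?_⟩
  have hx' : x ∉ tsupport ψ := fun hmem => by
    have := hR hmem
    rw [mem_closedBall_zero_iff, Real.norm_eq_abs] at this
    linarith [le_abs_self R]
  refine ⟨image_eq_zero_of_notMem_tsupport hx', ?_⟩
  by_contra hne
  exact hx' (support_deriv_subset (Function.mem_support.2 hne))

theorem integral_eq_intervalIntegral_of_forall_abs_ge {f : ℝ → ℝ} {R : ℝ}
    (h : ∀ x, R ≤ |x| → f x = 0) : ∫ x, f x = ∫ x in (-R)..R, f x := by
  refine (intervalIntegral.integral_eq_integral_of_support_subset fun t ht => ?_).symm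
  have hlt : |t| < R := not_le.1 fun hle => ht (h t hle)
  exact ⟨(abs_lt.1 hlt).1, (abs_lt.1 hlt).2.le⟩

namespace IsH1

variable {v v' z z' : ℝ → ℝ}

theorem locallyIntegrable_deriv (hv : IsH1 v v') : LocallyIntegrable v' volume :=
  hv.memLp_deriv.locallyIntegrable (by norm_num)

theorem intervalIntegrable_deriv (hv : IsH1 v v') (x y : ℝ) :
    IntervalIntegrable v' volume x y :=
  intervalIntegrable_iff.mpr <|
    (hv.locallyIntegrable_deriv.integrableOn_isCompact isCompact_uIcc).mono_set uIoc_subset_uIcc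

/-- The primitive of v' has the same weak derivative as v, so the two differ by a constant, first
almost everywhere and then everywhere by continuity. -/
theorem sub_eq_integral (hv : IsH1 v v') (x y : ℝ) : v y - v x = ∫ t in x..y, v' t := by
  set w : ℝ → ℝ := fun x => ∫ t in (0 : ℝ)..x, v' t with hw
  have hwd : ∀ x y, w y - w x = ∫ t in x..y, v' t := fun x y =>
    intervalIntegral.integral_interval_sub_left (hv.intervalIntegrable_deriv _ _)
      (hv.intervalIntegrable_deriv _ _)
  have hwc : Continuous w :=
    intervalIntegral.continuous_primitive (fun a b => hv.intervalIntegrable_deriv a b) 0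
  obtain ⟨c, hc⟩ := exists_ae_eq_const_of_integral_mul_deriv_eq_zero
    (f := fun x => v x - w x) (hv.continuous.sub hwc).locallyIntegrable (fun ψ hψ hψc => by
      have h1 := hv.weak_deriv ψ hψ hψc
      have hψ' : Continuous (deriv ψ) := hψ.continuous_deriv (by simp)
      have h2 : ∫ x, w x * deriv ψ x = - ∫ x, v' x * ψ x := by
        obtain ⟨R, -, hR⟩ := exists_Icc_support hψc
        rw [integral_eq_intervalIntegral_of_forall_abs_ge (R := R)
            (fun x hx => by rw [(hR x hx).2, mul_zero]),
          integral_eq_intervalIntegral_of_forall_abs_ge (R := R)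
            (fun x hx => by rw [(hR x hx).1, mul_zero])]
        have := intervalIntegral_mul_deriv_eq_of_primitive
          (fun x => (hψ.differentiable (by simp) x).hasDerivAt) hψ'
          hv.locallyIntegrable_deriv hwd (-R) R
        rw [(hR R (le_abs_self _)).1, (hR (-R) (by rw [abs_neg]; exact le_abs_self _)).1] at this
        simp only [mul_comm (w _), mul_comm (v' _)]
        linarith
      simp only [sub_mul]
      rw [integral_sub, h1, h2, sub_self]
      · exact (hv.continuous.mul hψ').integrable_of_hasCompactSupport hψc.deriv.mul_left
      · exact (hwc.mul hψ').integrable_of_hasCompactSupport hψc.deriv.mul_left)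
  have := (Continuous.ae_eq_iff_eq (volume : Measure ℝ) (hv.continuous.sub hwc)
    continuous_const).1 hc
  have hx := congrFun this x
  have hy := congrFun this y
  change v x - w x = c at hx
  change v y - w y = c at hy
  rw [← hwd]
  linarith

theorem comp_neg (hv : IsH1 v v') : IsH1 (fun x => v (-x)) (fun x => -v' (-x)) where
  continuous := hv.continuous.comp continuous_neg
  memLp := hv.memLp.comp_measurePreserving (Measure.measurePreserving_neg volume)
  memLp_deriv := (hv.memLp_deriv.comp_measurePreserving (Measure.measurePreserving_neg volume)).neg
  weak_deriv := fun ψ h hc => by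
    have h1 := hv.weak_deriv (fun x => ψ (-x)) (h.comp contDiff_neg)
      (hc.comp_homeomorph (Homeomorph.neg ℝ))
    have e1 : ∀ x, v x * deriv (fun y => ψ (-y)) x = -(v x * deriv ψ (-x)) := fun x => by
      rw [deriv_comp_neg, mul_neg]
    have e2 : ∫ x, v (-x) * deriv ψ x = ∫ x, v x * deriv ψ (-x) := by
      rw [← integral_neg_eq_self]
      simp only [neg_neg]
    have e3 : ∫ x, -v' (-x) * ψ x = -∫ x, v' x * ψ (-x) := by
      rw [← integral_neg]
      refine (integral_neg_eq_self (fun x => -v' (-x) * ψ x) volume).symm.trans ?_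
      refine integral_congr_ae (ae_of_all _ fun x => ?_)
      change -v' (- -x) * ψ (-x) = -(v' x * ψ (-x))
      rw [neg_neg, neg_mul]
    rw [integral_congr_ae (ae_of_all _ e1), integral_neg] at h1
    rw [e2, e3]
    linarith

end IsH1

theorem integral_eq_add_integral_Ioi {f : ℝ → ℝ} (hf : Integrable f) :
    ∫ x, f x = (∫ x in Ioi (0 : ℝ), f x) + ∫ x in Ioi (0 : ℝ), f (-x) := by
  rw [integral_comp_neg_Ioi, neg_zero, add_comm]
  exact (intervalIntegral.integral_Iic_add_Ioi hf.integrableOn hf.integrableOn).symm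

theorem tendsto_zero_of_integrableOn_Ioi_of_tendsto {f : ℝ → ℝ} {L : ℝ}
    (hf : IntegrableOn f (Ioi 0)) (hL : Tendsto f atTop (𝓝 L)) : L = 0 := by
  have : IntegrableAtFilter f atTop := ⟨Ioi 0, Ioi_mem_atTop _, hf⟩
  refine IntegrableAtFilter.eq_zero_of_tendsto this (fun s hs => ?_) hL
  rcases mem_atTop_sets.1 hs with ⟨b, hb⟩
  rw [← top_le_iff, ← Real.volume_Ici (a := b)]
  exact measure_mono hb

/-- No boundary term appears at infinity: g z has a limit there because both integrals converge, and
integrability of g z forces the limit to be 0. -/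
theorem integral_Ioi_mul_deriv_of_isH1 {g g' z z' : ℝ → ℝ}
    (hg : ∀ x, HasDerivAt g (g' x) x) (hg' : Continuous g') (hz : IsH1 z z')
    (h1 : IntegrableOn (fun x => g x * z' x) (Ioi 0))
    (h2 : IntegrableOn (fun x => g' x * z x) (Ioi 0))
    (h3 : IntegrableOn (fun x => g x * z x) (Ioi 0)) :
    ∫ x in Ioi (0 : ℝ), g x * z' x = -(g 0 * z 0) - ∫ x in Ioi (0 : ℝ), g' x * z x := by
  have t1 := intervalIntegral_tendsto_integral_Ioi 0 h1 tendsto_id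
  have t2 := intervalIntegral_tendsto_integral_Ioi 0 h2 tendsto_id
  have e : ∀ X : ℝ, g X * z X = g 0 * z 0 + (∫ x in (0 : ℝ)..X, g x * z' x) +
      ∫ x in (0 : ℝ)..X, g' x * z x := fun X => by
    rw [intervalIntegral_mul_deriv_eq_of_primitive hg hg' hz.locallyIntegrable_deriv
      hz.sub_eq_integral]
    ring
  have t3 : Tendsto (fun X => g X * z X) atTop (𝓝 (g 0 * z 0 + (∫ x in Ioi (0 : ℝ), g x * z' x) +
      ∫ x in Ioi (0 : ℝ), g' x * z x)) := by
    rw [funext e]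
    exact (tendsto_const_nhds.add t1).add t2
  have := tendsto_zero_of_integrableOn_Ioi_of_tendsto h3 t3
  linarith

/-! ### Classical regularity of weak eigenfunctions -/

/-- The derivative off the origin of a solution of `-v'' + Q v = 0` with a delta interaction of
strength `γ` at the origin, recovered from the `C¹` function `e = v' + (γ/2) sign(x) v(0)`. -/
def offDeriv (γ : ℝ) (v e : ℝ → ℝ) (x : ℝ) : ℝ := e x - γ / 2 * Real.sign x * v 0

/-- `v` is a square integrable solution of `-v'' - γ δ v + Q v = 0`; the jump of `v'` at the origin
is encoded by requiring that `e = v' + (γ/2) sign(x) v(0)` be differentiable everywhere. -/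
structure IsDeltaSol (γ : ℝ) (Q v e : ℝ → ℝ) : Prop where
  continuous : Continuous v
  hasDerivAt_aux : ∀ x, HasDerivAt e (Q x * v x) x
  hasDerivAt : ∀ x, x ≠ 0 → HasDerivAt v (offDeriv γ v e x) x
  memLp : MemLp v 2 volume
  memLp_deriv : MemLp (offDeriv γ v e) 2 volume

theorem measurable_sign : Measurable Real.sign := by
  unfold Real.sign
  exact Measurable.ite measurableSet_Iio measurable_const
    (Measurable.ite measurableSet_Ioi measurable_const measurable_const)

theorem abs_sign_le_one (x : ℝ) : |Real.sign x| ≤ 1 := by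
  rcases Real.sign_apply_eq x with h | h | h <;> rw [h] <;> simp

theorem locallyIntegrable_sign : LocallyIntegrable Real.sign volume :=
  (locallyIntegrable_const (1 : ℝ)).mono measurable_sign.aestronglyMeasurable
    (ae_of_all _ fun x => by simpa using abs_sign_le_one x)

theorem integral_sign_mul_deriv {ψ : ℝ → ℝ} (hψ : ContDiff ℝ (⊤ : ℕ∞) ψ)
    (hc : HasCompactSupport ψ) : ∫ x, Real.sign x * deriv ψ x = -2 * ψ 0 := by
  have hψ' : Continuous (deriv ψ) := hψ.continuous_deriv (by simp)
  have hi : Integrable (deriv ψ) := hψ'.integrable_of_hasCompactSupport hc.deriv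
  have hint : Integrable (fun x => Real.sign x * deriv ψ x) :=
    hi.bdd_mul (c := 1) measurable_sign.aestronglyMeasurable (ae_of_all _ abs_sign_le_one)
  have h1 : ContDiff ℝ 1 ψ := hψ.of_le (by simp)
  rw [← intervalIntegral.integral_Iic_add_Ioi (b := 0) hint.integrableOn hint.integrableOn,
    integral_Iic_eq_integral_Iio,
    setIntegral_congr_fun (g := fun x => -deriv ψ x) measurableSet_Iio
      (fun x hx => by simp only [Real.sign_of_neg hx, neg_one_mul]),
    setIntegral_congr_fun (g := deriv ψ) measurableSet_Ioi
      (fun x hx => by simp only [Real.sign_of_pos hx, one_mul]),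
    integral_neg, ← integral_Iic_eq_integral_Iio, hc.integral_Ioi_deriv_eq h1,
    hc.integral_Iic_deriv_eq h1]
  ring

/-- The derivative of sign is 2δ, so adding (γ/2) v(0) sign to v' absorbs the delta term. What
remains has weak derivative Qv, hence equals a primitive of Qv up to a constant; this is the
function e. -/
theorem IsH1.exists_isDeltaSol {γ μ ω : ℝ} {V : ℝ →ᵇ ℝ} {v v' : ℝ → ℝ} (hv : IsH1 v v')
    (h : ∀ z z' : ℝ → ℝ, IsH1 z z' → bilinForm ω γ V v v' z z' = ∫ x, μ * v x * z x) :
    ∃ e, IsDeltaSol γ (fun x => ω - V x - μ) v e ∧ v' =ᵐ[volume] offDeriv γ v e := by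
  set Q : ℝ → ℝ := fun x => ω - V x - μ with hQ
  have hQc : Continuous Q := by fun_prop
  have hQv : Continuous (fun x => Q x * v x) := hQc.mul hv.continuous
  let g : ℝ → ℝ := fun x => ∫ t in (0 : ℝ)..x, Q t * v t
  have hg : ∀ x, HasDerivAt g (Q x * v x) x := fun x =>
    intervalIntegral.integral_hasDerivAt_right (hQv.intervalIntegrable _ _)
      hQv.stronglyMeasurable.stronglyMeasurableAtFilter hQv.continuousAt
  have hgc : Continuous g := continuous_iff_continuousAt.2 fun x => (hg x).continuousAt
  have hsl : LocallyIntegrable (fun x => γ / 2 * v 0 * Real.sign x) volume :=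
    locallyIntegrable_sign.smul (γ / 2 * v 0)
  obtain ⟨c, hc⟩ := exists_ae_eq_const_of_integral_mul_deriv_eq_zero
    (f := fun x => v' x - g x + γ / 2 * v 0 * Real.sign x)
    ((hv.locallyIntegrable_deriv.sub hgc.locallyIntegrable).add hsl) (fun ψ hψ hψc => by
      have hψ' : Continuous (deriv ψ) := hψ.continuous_deriv (by simp)
      have m1 := memLp_of_test hψ.continuous hψc
      have m2 := memLp_of_test hψ' hψc.deriv
      have i1 : Integrable (fun x => v' x * deriv ψ x) := integrable_mul_of_memLp hv.memLp_deriv m2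
      have i2 : Integrable (fun x => g x * deriv ψ x) :=
        (hgc.mul hψ').integrable_of_hasCompactSupport hψc.deriv.mul_left
      have i3 : Integrable (fun x => Real.sign x * deriv ψ x) :=
        (hψ'.integrable_of_hasCompactSupport hψc.deriv).bdd_mul (c := 1)
          measurable_sign.aestronglyMeasurable (ae_of_all _ abs_sign_le_one)
      have i4 : Integrable (fun x => v x * ψ x) := integrable_mul_of_memLp hv.memLp m1
      have i5 : Integrable (fun x => V x * v x * ψ x) := integrable_potential_mul V hv.memLp m1
      have h1 := h ψ (deriv ψ) (IsH1.of_test hψ hψc)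
      have h2 : ∫ x, g x * deriv ψ x = -∫ x, Q x * v x * ψ x :=
        integral_mul_deriv_eq_deriv_mul_of_integrable (fun x _ => hg x)
          (fun x _ => (hψ.differentiable (by simp) x).hasDerivAt) i2
          ((hQv.mul hψ.continuous).integrable_of_hasCompactSupport hψc.mul_left)
          ((hgc.mul hψ.continuous).integrable_of_hasCompactSupport hψc.mul_left)
      have h3 : ∫ x, Q x * v x * ψ x =
          ω * (∫ x, v x * ψ x) - (∫ x, V x * v x * ψ x) - μ * ∫ x, v x * ψ x := by
        have i6 : Integrable (fun x => ω * (v x * ψ x) - V x * v x * ψ x) := (i4.const_mul ω).sub i5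
        rw [← integral_const_mul, ← integral_const_mul, ← integral_sub (i4.const_mul ω) i5,
          ← integral_sub i6 (i4.const_mul μ)]
        refine integral_congr_ae (ae_of_all _ fun x => ?_)
        simp only [hQ]
        ring
      have h4 := integral_sign_mul_deriv hψ hψc
      have e : ∀ x, (v' x - g x + γ / 2 * v 0 * Real.sign x) * deriv ψ x =
          v' x * deriv ψ x - g x * deriv ψ x + γ / 2 * v 0 * (Real.sign x * deriv ψ x) :=
        fun x => by ring
      have i7 : Integrable (fun x => v' x * deriv ψ x - g x * deriv ψ x) := i1.sub i2
      rw [integral_congr_ae (ae_of_all _ e), integral_add i7 (i3.const_mul _),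
        integral_sub i1 i2, integral_const_mul, h4, h2, h3]
      simp only [bilinForm, mul_assoc μ, integral_const_mul] at h1
      linarith)
  have hae : v' =ᵐ[volume] offDeriv γ v (fun x => c + g x) := by
    filter_upwards [hc] with x hx
    simp only [offDeriv]
    linarith
  refine ⟨fun x => c + g x, ⟨hv.continuous, fun x => (hg x).const_add c, fun x hx => ?_,
    hv.memLp, hv.memLp_deriv.ae_eq hae⟩, hae⟩
  -- The representative of v' is continuous off the origin, so differentiating this integral
  -- upgrades the weak derivative to a classical one.
  have hvx : v = fun x => v 0 + ∫ t in (0 : ℝ)..x, offDeriv γ v (fun x => c + g x) t := by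
    funext y
    have h1 := hv.sub_eq_integral 0 y
    rw [intervalIntegral.integral_congr_ae (g := offDeriv γ v (fun x => c + g x))
      (hae.mono fun _ h _ => h)] at h1
    linarith
  have hloc : LocallyIntegrable (offDeriv γ v (fun x => c + g x)) volume :=
    (hv.memLp_deriv.ae_eq hae).locallyIntegrable (by norm_num)
  have hcx : ContinuousAt (offDeriv γ v (fun x => c + g x)) x := by
    have : ContinuousAt Real.sign x := by
      rcases lt_or_gt_of_ne hx with h | h
      · refine (continuousAt_const (y := (-1 : ℝ))).congr ?_
        filter_upwards [Iio_mem_nhds h] with y hy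
        exact (Real.sign_of_neg hy).symm
      · refine (continuousAt_const (y := (1 : ℝ))).congr ?_
        filter_upwards [Ioi_mem_nhds h] with y hy
        exact (Real.sign_of_pos hy).symm
    exact (continuousAt_const.add hgc.continuousAt).sub
      ((continuousAt_const.mul this).mul continuousAt_const)
  have key : HasDerivAt (fun x => v 0 + ∫ t in (0 : ℝ)..x, offDeriv γ v (fun x => c + g x) t)
      (offDeriv γ v (fun x => c + g x) x) x := by
    refine (intervalIntegral.integral_hasDerivAt_right ?_ ?_ hcx).const_add _
    · exact intervalIntegrable_iff.mpr <|
        (hloc.integrableOn_isCompact isCompact_uIcc).mono_set uIoc_subset_uIcc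
    · exact ⟨univ, univ_mem, by simpa using hloc.aestronglyMeasurable⟩
  rwa [← hvx] at key

/-! ### Riccati lower bounds for the energy -/

/-- `v` is continuous, square integrable, and differentiable off the origin with square integrable
derivative `d`. -/
structure IsOffDiff (v d : ℝ → ℝ) : Prop where
  continuous : Continuous v
  hasDerivAt : ∀ x, x ≠ 0 → HasDerivAt v (d x) x
  memLp : MemLp v 2 volume
  memLp_deriv : MemLp d 2 volume

theorem IsDeltaSol.isOffDiff {γ : ℝ} {Q v e : ℝ → ℝ} (h : IsDeltaSol γ Q v e) :
    IsOffDiff v (offDeriv γ v e) :=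
  ⟨h.continuous, h.hasDerivAt, h.memLp, h.memLp_deriv⟩

namespace IsOffDiff

variable {v d u f : ℝ → ℝ}

theorem add (hv : IsOffDiff v d) (hu : IsOffDiff u f) : IsOffDiff (v + u) (d + f) :=
  ⟨hv.continuous.add hu.continuous, fun x hx => (hv.hasDerivAt x hx).add (hu.hasDerivAt x hx),
    hv.memLp.add hu.memLp, hv.memLp_deriv.add hu.memLp_deriv⟩

theorem smul (c : ℝ) (hv : IsOffDiff v d) : IsOffDiff (c • v) (c • d) :=
  ⟨hv.continuous.const_smul c, fun x hx => (hv.hasDerivAt x hx).const_smul c,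
    hv.memLp.const_smul c, hv.memLp_deriv.const_smul c⟩

theorem comp_neg (hv : IsOffDiff v d) : IsOffDiff (fun x => v (-x)) (fun x => -d (-x)) where
  continuous := hv.continuous.comp continuous_neg
  hasDerivAt x hx := by
    simpa [Function.comp_def] using (hv.hasDerivAt (-x) (neg_ne_zero.2 hx)).comp x (hasDerivAt_neg x)
  memLp := hv.memLp.comp_measurePreserving (Measure.measurePreserving_neg volume)
  memLp_deriv := (hv.memLp_deriv.comp_measurePreserving (Measure.measurePreserving_neg volume)).neg

theorem tendsto_sq_atTop (hv : IsOffDiff v d) : Tendsto (fun x => v x ^ 2) atTop (𝓝 0) := by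
  refine tendsto_zero_of_hasDerivAt_of_integrableOn_Ioi (a := 0) (f' := fun x => 2 * (v x * d x))
    (fun x hx => ?_) ((integrable_mul_of_memLp hv.memLp hv.memLp_deriv).const_mul 2).integrableOn
    hv.memLp.integrable_sq.integrableOn
  convert! (hv.hasDerivAt x (ne_of_gt hx)).fun_pow 2 using 1
  simp only [Nat.cast_ofNat, Nat.reduceSub, pow_one]
  ring

/-- Jacobi's lower bound for the energy on a half line, for a solution `r` of the Riccati equation
`r' + r² = Q` that may be singular at a single point. -/
theorem neg_le_integral_Ioi_of_riccati (hv : IsOffDiff v d) {r Q : ℝ → ℝ} {x₀ C : ℝ}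
    (hx₀ : 0 ≤ x₀) (hr : ∀ x, 0 < x → x ≠ x₀ → HasDerivAt r (Q x - r x ^ 2) x)
    (hcont : ContinuousOn (fun x => r x * v x ^ 2) (Ici 0))
    (hbdd : ∀ᶠ x in atTop, |r x| ≤ C)
    (hQ : Integrable (fun x => Q x * v x ^ 2)) :
    -(r 0 * v 0 ^ 2) ≤ ∫ x in Ioi (0 : ℝ), (d x ^ 2 + Q x * v x ^ 2) := by
  have hint : Integrable (fun x => d x ^ 2 + Q x * v x ^ 2) := hv.memLp_deriv.integrable_sq.add hQ
  -- The energy density minus (r v²)' is (d - r v)². The singular point may be an endpoint, because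
  -- r v² is assumed continuous across it.
  have key : ∀ α β : ℝ, 0 ≤ α → α ≤ β → x₀ ∉ Ioo α β →
      r β * v β ^ 2 - r α * v α ^ 2 ≤ ∫ x in α..β, (d x ^ 2 + Q x * v x ^ 2) := by
    intro α β hα hαβ hx
    refine intervalIntegral.sub_le_integral_of_hasDeriv_right_of_le hαβ
      (g' := fun x => (Q x - r x ^ 2) * v x ^ 2 + r x * (2 * (v x * d x)))
      (hcont.mono fun x hx => hα.trans hx.1) (fun x hxm => ?_) hint.integrableOn (fun x _ => ?_)
    · have hx0 : 0 < x := hα.trans_lt hxm.1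
      have h2 := (hv.hasDerivAt x hx0.ne').fun_pow 2
      have h3 := (hr x hx0 (fun h => hx (h ▸ hxm))).fun_mul h2
      refine (h3.congr_deriv ?_).hasDerivWithinAt
      simp only [Nat.cast_ofNat, Nat.reduceSub, pow_one]
      ring
    · nlinarith [sq_nonneg (d x - r x * v x)]
  have hge : ∀ᶠ X in atTop, r X * v X ^ 2 - r 0 * v 0 ^ 2 ≤
      ∫ x in (0 : ℝ)..X, (d x ^ 2 + Q x * v x ^ 2) := by
    filter_upwards [eventually_ge_atTop x₀] with X hX
    rw [← intervalIntegral.integral_add_adjacent_intervals (b := x₀)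
      hint.intervalIntegrable hint.intervalIntegrable]
    have h1 := key 0 x₀ le_rfl hx₀ (fun h => lt_irrefl _ h.2)
    have h2 := key x₀ X hx₀ hX (fun h => lt_irrefl _ h.1)
    linarith
  have hlim : Tendsto (fun X => r X * v X ^ 2 - r 0 * v 0 ^ 2) atTop (𝓝 (0 - r 0 * v 0 ^ 2)) := by
    refine Tendsto.sub_const ?_ _
    refine squeeze_zero_norm' (a := fun X => C * v X ^ 2) ?_ ?_
    · filter_upwards [hbdd] with X hX
      rw [norm_mul, Real.norm_eq_abs, Real.norm_eq_abs, abs_of_nonneg (sq_nonneg (v X))]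
      gcongr
    · simpa using hv.tendsto_sq_atTop.const_mul C
  have := le_of_tendsto_of_tendsto hlim
    (intervalIntegral_tendsto_integral_Ioi 0 hint.integrableOn tendsto_id) hge
  linarith

end IsOffDiff

theorem hasDerivAt_tanh (x : ℝ) : HasDerivAt Real.tanh (1 - Real.tanh x ^ 2) x := by
  have h := (Real.hasDerivAt_sinh x).div (Real.hasDerivAt_cosh x) (Real.cosh_pos x).ne'
  have e : Real.tanh = Real.sinh / Real.cosh := by
    funext y; simp [Real.tanh_eq_sinh_div_cosh]
  rw [← e] at h
  convert! h using 1
  rw [Real.tanh_eq_sinh_div_cosh]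
  have := (Real.cosh_pos x).ne'
  field_simp

theorem one_div_cosh_sq (x : ℝ) : (1 / Real.cosh x) ^ 2 = 1 - Real.tanh x ^ 2 := by
  rw [Real.tanh_eq_sinh_div_cosh]
  have := (Real.cosh_pos x).ne'
  field_simp
  linarith [Real.cosh_sq x]

theorem continuous_tanh : Continuous Real.tanh :=
  continuous_iff_continuousAt.2 fun x => (hasDerivAt_tanh x).continuousAt

theorem hasDerivAt_tanh_affine (a b x : ℝ) :
    HasDerivAt (fun x => Real.tanh (a * x + b)) (a * (1 - Real.tanh (a * x + b) ^ 2)) x := by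
  have h1 : HasDerivAt (fun x : ℝ => a * x + b) a x := by
    simpa using ((hasDerivAt_id x).const_mul a).add_const b
  have := (hasDerivAt_tanh (a * x + b)).comp x h1
  rw [mul_comm]
  exact this

/-- The potential `a² ((N-1)² - M sech²(a|x|+b))`. -/
def wellPotential (a b N M x : ℝ) : ℝ :=
  a ^ 2 * ((N - 1) ^ 2 - M * (1 - Real.tanh (a * |x| + b) ^ 2))

theorem wellPotential_neg (a b N M x : ℝ) :
    wellPotential a b N M (-x) = wellPotential a b N M x := by
  simp [wellPotential]

section Energy

variable {v d : ℝ → ℝ} {a b N M : ℝ}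

theorem integrable_energy_reflect (hv : IsOffDiff v d)
    (hQ : Integrable (fun x => wellPotential a b N M x * v x ^ 2)) :
    ∫ x, (d x ^ 2 + wellPotential a b N M x * v x ^ 2) =
      (∫ x in Ioi (0 : ℝ), (d x ^ 2 + wellPotential a b N M x * v x ^ 2)) +
      ∫ x in Ioi (0 : ℝ), ((-d (-x)) ^ 2 + wellPotential a b N M x * v (-x) ^ 2) := by
  have h : Integrable (fun x => d x ^ 2 + wellPotential a b N M x * v x ^ 2) :=
    hv.memLp_deriv.integrable_sq.add hQ
  rw [integral_eq_add_integral_Ioi h]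
  simp only [wellPotential_neg, neg_sq]

/-- On the right half line, r = -a(N-1) tanh(ax+b) is the logarithmic derivative of
cosh^(-(N-1))(ax+b), a multiple of the profile. The boundary terms of the two half lines match the
delta term exactly. -/
theorem energy_nonneg_of_ground (hv : IsOffDiff v d)
    (hQ : Integrable (fun x => wellPotential a b N (N * (N - 1)) x * v x ^ 2)) :
    0 ≤ (∫ x, (d x ^ 2 + wellPotential a b N (N * (N - 1)) x * v x ^ 2)) -
      2 * a * (N - 1) * Real.tanh b * v 0 ^ 2 := by
  have half : ∀ {v d : ℝ → ℝ}, IsOffDiff v d →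
      Integrable (fun x => wellPotential a b N (N * (N - 1)) x * v x ^ 2) →
      a * (N - 1) * Real.tanh b * v 0 ^ 2 ≤
        ∫ x in Ioi (0 : ℝ), (d x ^ 2 + wellPotential a b N (N * (N - 1)) x * v x ^ 2) := by
    intro v d hv hQ
    -- This r has no pole, so the exceptional point is parked at the endpoint 0.
    have := hv.neg_le_integral_Ioi_of_riccati (x₀ := 0) (C := |a * (N - 1)|)
      (r := fun x => -(a * (N - 1)) * Real.tanh (a * x + b)) le_rfl (fun x hx _ => ?_) ?_ ?_ hQ
    · simpa using this
    · convert! (hasDerivAt_tanh_affine a b x).const_mul (-(a * (N - 1))) using 1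
      rw [wellPotential, abs_of_pos hx]
      ring
    · have := continuous_tanh
      have := hv.continuous
      fun_prop
    · refine Eventually.of_forall fun x => ?_
      rw [abs_mul, abs_neg]
      exact mul_le_of_le_one_right (abs_nonneg _) (Real.abs_tanh_lt_one _).le
  rw [integrable_energy_reflect hv hQ]
  have h1 := half hv hQ
  have h2 := half hv.comp_neg (by simpa [wellPotential_neg] using hQ.comp_neg)
  rw [neg_zero] at h2
  linarith

/-- With t = tanh(ax+b), r = a(1/t - Nt) is the logarithmic derivative of t cosh^(-(N-1)), a
multiple of the derivative of the profile. Its simple pole at x = -b/a is harmless because v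
vanishes there. -/
theorem energy_nonneg_of_nodes (hv : IsOffDiff v d) (ha : 0 < a) (hb : b < 0)
    (h₁ : v (-b / a) = 0) (h₂ : v (-(-b / a)) = 0)
    (hQ : Integrable (fun x => wellPotential a b N (N * (N + 1)) x * v x ^ 2)) :
    0 ≤ (∫ x, (d x ^ 2 + wellPotential a b N (N * (N + 1)) x * v x ^ 2)) -
      2 * a * (N - 1) * Real.tanh b * v 0 ^ 2 := by
  have ht : Real.tanh b < 0 := by
    rw [Real.tanh_eq_sinh_div_cosh]
    exact div_neg_of_neg_of_pos (Real.sinh_neg_iff.2 hb) (Real.cosh_pos b)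
  set x₀ := -b / a with hx₀
  have hx₀' : 0 < x₀ := div_pos (neg_pos.2 hb) ha
  have hax₀ : a * x₀ + b = 0 := by rw [hx₀]; field_simp; ring
  set t : ℝ → ℝ := fun x => Real.tanh (a * x + b) with htdef
  have htne : ∀ x, x ≠ x₀ → t x ≠ 0 := by
    intro x hx h
    have hs : Real.sinh (a * x + b) = 0 := by
      have := h
      simp only [htdef, Real.tanh_eq_sinh_div_cosh] at this
      exact (div_eq_zero_iff.1 this).resolve_right (Real.cosh_pos _).ne'
    rw [Real.sinh_eq_zero] at hs
    exact hx (mul_left_cancel₀ ha.ne' (by linarith))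
  have htd : ∀ x, HasDerivAt t (a * (1 - t x ^ 2)) x := hasDerivAt_tanh_affine a b
  have htc : Continuous t := continuous_iff_continuousAt.2 fun x => (htd x).continuousAt
  have htx₀ : t x₀ = 0 := by simp [htdef, hax₀]
  have half : ∀ {v d : ℝ → ℝ}, IsOffDiff v d → v x₀ = 0 →
      Integrable (fun x => wellPotential a b N (N * (N + 1)) x * v x ^ 2) →
      -(a * ((t 0)⁻¹ - N * t 0) * v 0 ^ 2) ≤
        ∫ x in Ioi (0 : ℝ), (d x ^ 2 + wellPotential a b N (N * (N + 1)) x * v x ^ 2) := by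
    intro v d hv h0 hQ
    refine hv.neg_le_integral_Ioi_of_riccati (x₀ := x₀)
      (C := a * ((t (x₀ + 1))⁻¹ + |N|))
      (r := fun x => a * ((t x)⁻¹ - N * t x)) hx₀'.le (fun x hx hne => ?_) ?_ ?_ hQ
    · convert! (((htd x).inv (htne x hne)).sub ((htd x).const_mul N)).const_mul a using 1
      rw [wellPotential, abs_of_pos hx]
      change a ^ 2 * ((N - 1) ^ 2 - N * (N + 1) * (1 - t x ^ 2)) - _ = _
      have := htne x hne
      field_simp
      ring
    · refine continuousOn_of_forall_continuousAt fun x _ => ?_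
      rcases eq_or_ne x x₀ with rfl | hne
      · have e : (fun x => a * ((t x)⁻¹ - N * t x) * v x ^ 2) =
            fun x => a * ((t x)⁻¹ * v x * v x) - a * (N * t x) * v x ^ 2 := by
          funext x; ring
        rw [e]
        refine ContinuousAt.sub (continuousAt_const.mul ?_) ?_
        · rw [continuousAt_iff_punctured_nhds, h0, mul_zero]
          -- At the pole v/t tends to the quotient of the derivatives, so v²/t tends to 0.
          have s1 := hasDerivAt_iff_tendsto_slope.1 (hv.hasDerivAt x₀ hx₀'.ne')
          have s2 := hasDerivAt_iff_tendsto_slope.1 (htd x₀)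
          rw [htx₀] at s2
          have hane : a * (1 - 0 ^ 2) ≠ 0 := by simpa using ha.ne'
          have s3 := (s2.inv₀ hane).mul s1
          have s4 := s3.mul ((hv.continuous.tendsto x₀).mono_left nhdsWithin_le_nhds)
          rw [h0, mul_zero] at s4
          refine s4.congr' ?_
          filter_upwards [self_mem_nhdsWithin] with x hx
          have hx1 : x - x₀ ≠ 0 := sub_ne_zero.2 hx
          have hx2 := htne x hx
          simp only [slope_def_field, htx₀, h0, sub_zero]
          field_simp
        · exact ((continuous_const.mul (continuous_const.mul htc)).mul
            (hv.continuous.pow 2)).continuousAt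
      · exact (continuousAt_const.mul ((htc.continuousAt.inv₀ (htne x hne)).sub
          (continuousAt_const.mul htc.continuousAt))).mul (hv.continuous.continuousAt.pow 2)
    · have hmono : StrictMono t := strictMono_of_hasDerivAt_pos htd fun x =>
        mul_pos ha (by linarith [Real.tanh_sq_lt_one (a * x + b)])
      have hpos : 0 < t (x₀ + 1) := by
        rw [← htx₀]; exact hmono (by linarith)
      filter_upwards [eventually_ge_atTop (x₀ + 1)] with x hx
      have h1 : t (x₀ + 1) ≤ t x := hmono.monotone hx
      rw [abs_mul, abs_of_pos ha]
      gcongr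
      refine (abs_sub _ _).trans (add_le_add ?_ ?_)
      · rw [abs_of_pos (inv_pos.2 (hpos.trans_le h1))]
        exact inv_anti₀ hpos h1
      · rw [abs_mul]
        exact mul_le_of_le_one_right (abs_nonneg _) (Real.abs_tanh_lt_one _).le
  rw [integrable_energy_reflect hv hQ]
  have e1 := half hv h₁ hQ
  have e2 := half hv.comp_neg h₂ (by simpa [wellPotential_neg] using hQ.comp_neg)
  rw [neg_zero] at e2
  have ht0 : t 0 = Real.tanh b := by simp [htdef]
  rw [ht0] at e1 e2
  -- Here the boundary terms exceed the delta term; the surplus is nonnegative because tanh b < 0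
  -- and |tanh b| < 1.
  have e3 : 0 ≤ (-((Real.tanh b)⁻¹ - Real.tanh b)) * (a * v 0 ^ 2) := by
    refine mul_nonneg ?_ (by positivity)
    have : (Real.tanh b)⁻¹ - Real.tanh b = (1 - Real.tanh b ^ 2) / Real.tanh b := by
      have := ht.ne
      field_simp
    rw [this, neg_nonneg]
    exact div_nonpos_of_nonneg_of_nonpos (by linarith [Real.tanh_sq_lt_one b]) ht.le
  linarith

end Energy

/-! ### Uniqueness of square integrable solutions up to a scalar -/

open scoped InnerProductSpace

namespace IsDeltaSol

variable {γ : ℝ} {Q u e v f : ℝ → ℝ}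

theorem data_proportional (hu : IsDeltaSol γ Q u e) (hv : IsDeltaSol γ Q v f) :
    u 0 * f 0 = v 0 * e 0 := by
  -- This is the Wronskian for x > 0, written through the differentiable e and f so that it is
  -- continuous at 0, where the γ/2 correction vanishes.
  set w : ℝ → ℝ := fun x => u x * f x - v x * e x - γ / 2 * (u x * v 0 - v x * u 0) with hw
  have hec : Continuous e := continuous_iff_continuousAt.2 fun x => (hu.hasDerivAt_aux x).continuousAt
  have hfc : Continuous f := continuous_iff_continuousAt.2 fun x => (hv.hasDerivAt_aux x).continuousAt
  have hwc : Continuous w := by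
    have := hu.continuous
    have := hv.continuous
    fun_prop
  have hwpos : ∀ x, 0 < x → w x = u x * offDeriv γ v f x - v x * offDeriv γ u e x := by
    intro x hx
    simp only [hw, offDeriv, Real.sign_of_pos hx]
    ring
  have hwd : ∀ x, 0 < x → HasDerivAt w 0 x := by
    intro x hx
    have hu' := hu.hasDerivAt x hx.ne'
    have hv' := hv.hasDerivAt x hx.ne'
    have h := ((hu'.fun_mul (hv.hasDerivAt_aux x)).fun_sub
      (hv'.fun_mul (hu.hasDerivAt_aux x))).fun_sub
      (((hu'.mul_const (v 0)).fun_sub (hv'.mul_const (u 0))).const_mul (γ / 2))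
    refine h.congr_deriv ?_
    simp only [offDeriv, Real.sign_of_pos hx]
    ring
  have hconst : ∀ x, 0 < x → w x = w 0 := by
    intro x hx
    obtain ⟨c, -, hc⟩ := exists_hasDerivAt_eq_slope w (fun _ => 0) hx hwc.continuousOn
      (fun y hy => hwd y hy.1)
    have := (eq_div_iff (sub_ne_zero.2 hx.ne')).1 hc
    linarith
  have hint : IntegrableOn w (Ioi 0) := by
    refine IntegrableOn.congr_fun (f := fun x => u x * offDeriv γ v f x - v x * offDeriv γ u e x)
      ?_ (fun x hx => (hwpos x hx).symm) measurableSet_Ioi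
    exact ((integrable_mul_of_memLp hu.memLp hv.memLp_deriv).sub
      (integrable_mul_of_memLp hv.memLp hu.memLp_deriv)).integrableOn
  have h0 : w 0 = 0 := by
    refine tendsto_zero_of_integrableOn_Ioi_of_tendsto hint (tendsto_const_nhds.congr' ?_)
    filter_upwards [eventually_gt_atTop 0] with x hx
    exact (hconst x hx).symm
  simp only [hw] at h0
  linarith

theorem sub_smul (hu : IsDeltaSol γ Q u e) (hv : IsDeltaSol γ Q v f) (c : ℝ) :
    IsDeltaSol γ Q (fun x => u x - c * v x) (fun x => e x - c * f x) := by
  have hd : offDeriv γ (fun x => u x - c * v x) (fun x => e x - c * f x) =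
      fun x => offDeriv γ u e x - c * offDeriv γ v f x := by
    funext x
    simp only [offDeriv]
    ring
  refine ⟨hu.continuous.sub (continuous_const.mul hv.continuous), fun x => ?_, fun x hx => ?_,
    hu.memLp.sub (hv.memLp.const_mul c), ?_⟩
  · refine ((hu.hasDerivAt_aux x).fun_sub ((hv.hasDerivAt_aux x).const_mul c)).congr_deriv ?_
    ring
  · rw [hd]
    exact (hu.hasDerivAt x hx).fun_sub ((hv.hasDerivAt x hx).const_mul c)
  · rw [hd]
    exact hu.memLp_deriv.sub (hv.memLp_deriv.const_mul c)

/-- When u(0) = 0 there is no jump, so (u, e) solves on the whole line a linear first-order system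
with bounded coefficients, and Lipschitz uniqueness applies. -/
theorem eq_zero_of_data (hu : IsDeltaSol γ Q u e) {K : ℝ} (hK : ∀ x, |Q x| ≤ K)
    (hu0 : u 0 = 0) (he0 : e 0 = 0) : u = 0 := by
  have hec : Continuous e := continuous_iff_continuousAt.2 fun x => (hu.hasDerivAt_aux x).continuousAt
  have hud : ∀ x, HasDerivAt u (e x) x :=
    hasDerivAt_of_hasDerivAt_of_ne' (x := 0) (fun x hx => by
      simpa [offDeriv, hu0] using hu.hasDerivAt x hx) hu.continuous.continuousAt hec.continuousAt
  have hK0 : 0 ≤ K := (abs_nonneg _).trans (hK 0)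
  have hlip : ∀ t : ℝ, LipschitzOnWith (1 + K).toNNReal
      (fun y : ℝ × ℝ => (y.2, Q t * y.1)) univ := by
    intro t
    refine LipschitzWith.lipschitzOnWith (LipschitzWith.of_dist_le_mul fun y z => ?_)
    rw [Real.coe_toNNReal _ (by linarith), Prod.dist_eq, Prod.dist_eq]
    simp only [Real.dist_eq, ← mul_sub, abs_mul]
    set m := max |y.1 - z.1| |y.2 - z.2| with hm
    have h1 : |y.1 - z.1| ≤ m := le_max_left _ _
    have h2 : |y.2 - z.2| ≤ m := le_max_right _ _
    have h0 : 0 ≤ m := (abs_nonneg _).trans h1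
    have h3 : |Q t| * |y.1 - z.1| ≤ K * m := mul_le_mul (hK t) h1 (abs_nonneg _) hK0
    refine max_le ?_ ?_ <;> nlinarith
  have := ODE_solution_unique_univ (v := fun t y => (y.2, Q t * y.1)) (s := fun _ => univ)
    (f := fun x => (u x, e x)) (g := fun _ => 0) (t₀ := 0) hlip
    (fun t => ⟨(hud t).prodMk (hu.hasDerivAt_aux t), mem_univ _⟩)
    (fun t => ⟨by
      have h := hasDerivAt_const t (0 : ℝ × ℝ)
      rw [show ((0 : ℝ × ℝ).2, Q t * (0 : ℝ × ℝ).1) = 0 by simp]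
      exact h, mem_univ _⟩)
    (by simp [hu0, he0])
  funext x
  exact congrArg Prod.fst (congrFun this x)

theorem exists_eq_smul (hu : IsDeltaSol γ Q u e) (hv : IsDeltaSol γ Q v f) {K : ℝ}
    (hK : ∀ x, |Q x| ≤ K) (hne : v ≠ 0) : ∃ c : ℝ, u = c • v := by
  have hcross := hu.data_proportional hv
  obtain ⟨c, h1, h2⟩ : ∃ c : ℝ, u 0 - c * v 0 = 0 ∧ e 0 - c * f 0 = 0 := by
    by_cases h0 : v 0 = 0
    · have hf0 : f 0 ≠ 0 := fun hf0 => hne (hv.eq_zero_of_data hK h0 hf0)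
      have hu0 : u 0 = 0 := by
        rw [h0, zero_mul] at hcross
        exact (mul_eq_zero.1 hcross).resolve_right hf0
      exact ⟨e 0 / f 0, by rw [hu0, h0]; ring, by field_simp; ring⟩
    · refine ⟨u 0 / v 0, by field_simp; ring, ?_⟩
      field_simp
      linarith
  refine ⟨c, funext fun x => ?_⟩
  have := congrFun ((hu.sub_smul hv c).eq_zero_of_data hK h1 h2) x
  simp only [Pi.zero_apply] at this
  simp only [Pi.smul_apply, smul_eq_mul]
  linarith

end IsDeltaSol

/-! ### Eigenvectors of the form operator as solutions of the equation -/

section Graph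

variable {ω γ μ : ℝ} {V : ℝ →ᵇ ℝ}

theorem mem_eigenspace_formOperator {x : L2R} :
    x ∈ eigenspace (formOperator ω γ V) μ ↔ (x, μ • x) ∈ formGraph ω γ V := by
  rw [← formOperator_graph, LinearPMap.mem_graph_iff]
  constructor
  · rintro ⟨h, hx⟩
    exact ⟨⟨x, h⟩, rfl, hx⟩
  · rintro ⟨y, hy, hxy⟩
    obtain ⟨y, hyd⟩ := y
    obtain rfl : y = x := hy
    exact ⟨hyd, hxy⟩

theorem exists_isDeltaSol_of_mem_graph {x : L2R} (hx : (x, μ • x) ∈ formGraph ω γ V) :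
    ∃ v e, IsDeltaSol γ (fun t => ω - V t - μ) v e ∧ v =ᵐ[volume] x := by
  obtain ⟨v, v', hv, hvx, h⟩ := hx
  obtain ⟨e, he, -⟩ := hv.exists_isDeltaSol (γ := γ) (μ := μ) (ω := ω) (V := V) (fun z z' hz => by
    rw [h z z' hz]
    refine integral_congr_ae ?_
    filter_upwards [hvx, Lp.coeFn_smul μ x] with t h1 h2
    rw [h2, h1]
    rfl)
  exact ⟨v, e, he, hvx⟩

theorem abs_well_le (t : ℝ) : |ω - V t - μ| ≤ |ω| + ‖V‖ + |μ| :=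
  (abs_sub _ _).trans (add_le_add_left ((abs_sub _ _).trans
    (add_le_add_right (V.norm_coe_le_norm t) _)) _)

theorem finrank_eigenspace_formOperator (h : eigenspace (formOperator ω γ V) μ ≠ ⊥) :
    Module.finrank ℝ (eigenspace (formOperator ω γ V) μ) = 1 := by
  obtain ⟨x, hx, hx0⟩ := Submodule.exists_mem_ne_zero_of_ne_bot h
  obtain ⟨v, f, hv, hvx⟩ := exists_isDeltaSol_of_mem_graph (mem_eigenspace_formOperator.1 hx)
  have hv0 : v ≠ 0 := by
    rintro rfl
    exact hx0 (Lp.eq_zero_iff_ae_eq_zero.2 hvx.symm)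
  refine finrank_eq_one_iff'.2 ⟨⟨x, hx⟩, fun h => hx0 (congrArg Subtype.val h), ?_⟩
  rintro ⟨y, hy⟩
  obtain ⟨u, e, hu, huy⟩ := exists_isDeltaSol_of_mem_graph (mem_eigenspace_formOperator.1 hy)
  obtain ⟨c, hc⟩ := hu.exists_eq_smul hv abs_well_le hv0
  refine ⟨c, Subtype.ext (Lp.ext ?_)⟩
  refine (Lp.coeFn_smul c x).trans ?_
  filter_upwards [hvx, huy] with t h1 h2
  rw [← h2, hc, Pi.smul_apply, Pi.smul_apply, h1]

theorem inner_eq_integral_mul (x y : L2R) : ⟪x, y⟫_ℝ = ∫ t, x t * y t := by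
  rw [L2.inner_def]
  refine integral_congr_ae (ae_of_all _ fun t => ?_)
  simp [mul_comm]

theorem inner_formGraph_symm {q q' : L2R × L2R} (hq : q ∈ formGraph ω γ V)
    (hq' : q' ∈ formGraph ω γ V) : ⟪q.2, q'.1⟫_ℝ = ⟪q.1, q'.2⟫_ℝ := by
  obtain ⟨v, v', hv, hvq, h⟩ := hq
  obtain ⟨u, u', hu, huq, h'⟩ := hq'
  have h1 := h u u' hu
  have h2 := h' v v' hv
  rw [inner_eq_integral_mul, inner_eq_integral_mul]
  have e1 : ∫ t, q.2 t * q'.1 t = ∫ t, q.2 t * u t :=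
    integral_congr_ae (huq.mono fun t ht => by simp only [ht])
  have e2 : ∫ t, q.1 t * q'.2 t = ∫ t, q'.2 t * v t :=
    integral_congr_ae (hvq.mono fun t ht => by simp only [ht, mul_comm])
  rw [e1, e2, ← h1, ← h2]
  simp only [bilinForm, mul_comm (v' _), mul_comm (v _), mul_assoc]

theorem IsH1.ae_eq_of_isOffDiff {v v' d : ℝ → ℝ} (hv : IsH1 v v') (hd : IsOffDiff v d) :
    v' =ᵐ[volume] d := by
  have h0 : ∀ᵐ x : ℝ, x ≠ 0 := by simp [ae_iff, measure_singleton]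
  filter_upwards [_root_.LocallyIntegrable.ae_hasDerivAt_integral hv.locallyIntegrable_deriv, h0]
    with x hx hx0
  have h1 : HasDerivAt v (v' x) x := by
    have : v = fun y => v 0 + ∫ t in (0 : ℝ)..y, v' t :=
      funext fun y => by rw [← hv.sub_eq_integral]; ring
    rw [this]
    exact (hx 0).const_add _
  exact h1.unique (hd.hasDerivAt x hx0)

theorem IsOffDiff.isH1 {v d : ℝ → ℝ} (hv : IsOffDiff v d) : IsH1 v d where
  continuous := hv.continuous
  memLp := hv.memLp
  memLp_deriv := hv.memLp_deriv
  weak_deriv := fun ψ hψ hc => by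
    have m1 := memLp_of_test hψ.continuous hc
    have m2 := memLp_of_test (hψ.continuous_deriv (by simp)) hc.deriv
    have i1 : Integrable (fun x => v x * deriv ψ x) := integrable_mul_of_memLp hv.memLp m2
    have i2 : Integrable (fun x => d x * ψ x) := integrable_mul_of_memLp hv.memLp_deriv m1
    have i3 : Integrable (fun x => d x * ψ x + v x * deriv ψ x) := i2.add i1
    obtain ⟨R, -, hR⟩ := exists_Icc_support hc
    have h : ∫ x, (d x * ψ x + v x * deriv ψ x) = 0 := by
      rw [integral_eq_intervalIntegral_of_forall_abs_ge (R := R)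
        (fun x hx => by rw [(hR x hx).1, (hR x hx).2]; ring),
        integral_eq_of_hasDerivAt_off_countable (fun x => v x * ψ x) _ (countable_singleton 0)
          (hv.continuous.mul hψ.continuous).continuousOn
          (fun x hx => (hv.hasDerivAt x hx.2).fun_mul
            (hψ.differentiable (by simp) x).hasDerivAt) i3.intervalIntegrable]
      rw [(hR R (le_abs_self _)).1, (hR (-R) (by rw [abs_neg]; exact le_abs_self _)).1]
      ring
    rw [integral_add i2 i1] at h
    linarith

theorem integrable_sub_mul_sq {v : ℝ → ℝ} (hv : MemLp v 2 volume) :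
    Integrable (fun t => (ω - V t) * v t ^ 2) := by
  have h : Integrable (fun t => ω * v t ^ 2 - V t * v t * v t) :=
    (hv.integrable_sq.const_mul ω).sub (integrable_potential_mul V hv hv)
  refine h.congr (ae_of_all _ fun t => ?_)
  simp only
  ring

/-- The form is tested against v itself. It is stated for any point of the graph, since it is later
applied to combinations of eigenvectors. -/
theorem energy_eq_inner {q : L2R × L2R} (hq : q ∈ formGraph ω γ V) {v d : ℝ → ℝ}
    (hv : IsOffDiff v d) (hvq : v =ᵐ[volume] q.1) :
    (∫ t, (d t ^ 2 + (ω - V t) * v t ^ 2)) - γ * v 0 ^ 2 = ⟪q.2, q.1⟫_ℝ := by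
  obtain ⟨u, u', hu, huq, h⟩ := hq
  obtain rfl : u = v := (Continuous.ae_eq_iff_eq (volume : Measure ℝ) hu.continuous
    hv.continuous).1 (huq.trans hvq.symm)
  have e1 : ∫ t, q.2 t * q.1 t = ∫ t, q.2 t * u t :=
    integral_congr_ae (huq.mono fun t ht => by simp only [ht])
  have e2 : ∫ t, u' t * d t = ∫ t, d t ^ 2 :=
    integral_congr_ae ((hu.ae_eq_of_isOffDiff hv).mono fun t ht => by simp only [ht, sq])
  rw [inner_eq_integral_mul, e1, ← h u d hv.isH1, bilinForm, e2,
    integral_add hv.memLp_deriv.integrable_sq (integrable_sub_mul_sq hv.memLp)]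
  have e : ∫ t, (ω - V t) * u t ^ 2 = (∫ t, ω * (u t * u t)) - ∫ t, V t * u t * u t := by
    rw [← integral_sub ((integrable_mul_of_memLp hv.memLp hv.memLp).const_mul ω)
      (integrable_potential_mul V hv.memLp hv.memLp)]
    refine integral_congr_ae (ae_of_all _ fun t => ?_)
    simp only
    ring
  rw [e, integral_const_mul]
  ring

end Graph

/-! ### Power series with coefficients of polynomial growth -/

section PowerSeries

/-- The sum of the power series with coefficients `c`. -/
def powerSum (c : ℕ → ℝ) (z : ℝ) : ℝ := ∑' n, c n * z ^ n

/-- The coefficients of the termwise derivative. -/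
def derivCoeff (c : ℕ → ℝ) (n : ℕ) : ℝ := (n + 1) * c (n + 1)

/-- Coefficients of polynomial growth. -/
def PolyGrowth (C : ℝ) (M : ℕ) (c : ℕ → ℝ) : Prop := ∀ n, |c n| ≤ C * ((n + M).choose M : ℝ)

variable {C : ℝ} {M : ℕ} {c : ℕ → ℝ} {z : ℝ}

/-- Binomial weights are stable under termwise differentiation: (M+1)·C(n+M+1, M+1) = (n+1)·C(n+M+1,
M). -/
theorem PolyGrowth.derivCoeff (h : PolyGrowth C M c) :
    PolyGrowth (C * (M + 1)) (M + 1) (derivCoeff c) := by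
  intro n
  have h1 := h (n + 1)
  have h2 : ((n + (M + 1)).choose (M + 1) : ℝ) * (M + 1) = ((n + 1 + M).choose M : ℝ) * (n + 1) := by
    have := Nat.choose_succ_right_eq (n + 1 + M) M
    rw [show n + 1 + M - M = n + 1 by omega] at this
    rw [show n + (M + 1) = n + 1 + M by omega]
    exact_mod_cast this
  rw [DeltaNLS.derivCoeff, abs_mul, abs_of_nonneg (by positivity : (0 : ℝ) ≤ n + 1)]
  calc (n + 1 : ℝ) * |c (n + 1)| ≤ (n + 1) * (C * ((n + 1 + M).choose M : ℝ)) := by gcongr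
    _ = C * (((n + 1 + M).choose M : ℝ) * (n + 1)) := by ring
    _ = _ := by rw [← h2]; ring

theorem PolyGrowth.norm_le (h : PolyGrowth C M c) {r : ℝ} (hz : |z| ≤ r) (n : ℕ) :
    ‖c n * z ^ n‖ ≤ C * (((n + M).choose M : ℝ) * r ^ n) := by
  rw [norm_mul, norm_pow, Real.norm_eq_abs, Real.norm_eq_abs, ← mul_assoc]
  exact mul_le_mul (h n) (pow_le_pow_left₀ (abs_nonneg _) hz n) (by positivity)
    ((abs_nonneg _).trans (h n))

theorem summable_majorant (C : ℝ) (M : ℕ) {r : ℝ} (hr : |r| < 1) :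
    Summable fun n : ℕ => C * (((n + M).choose M : ℝ) * r ^ n) :=
  (summable_choose_mul_geometric_of_norm_lt_one M (by simpa using hr)).mul_left C

theorem PolyGrowth.summable (h : PolyGrowth C M c) (hz : |z| < 1) :
    Summable fun n => c n * z ^ n :=
  Summable.of_norm_bounded (summable_majorant C M (by rwa [abs_abs])) (h.norm_le le_rfl)

theorem PolyGrowth.hasDerivAt (h : PolyGrowth C M c) (hz : |z| < 1) :
    HasDerivAt (powerSum c) (powerSum (DeltaNLS.derivCoeff c) z) z := by
  obtain ⟨r, hzr, hr1⟩ := exists_between hz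
  have hr0 : 0 ≤ r := (abs_nonneg z).trans hzr.le
  have hd := h.derivCoeff
  have hu : Summable fun n : ℕ => ‖c n‖ * (n * r ^ (n - 1)) := by
    rw [← summable_nat_add_iff 1]
    refine Summable.of_norm_bounded (summable_majorant (C * (M + 1)) (M + 1)
      (by rwa [abs_of_nonneg hr0] : |r| < 1)) fun n => ?_
    refine le_trans (le_of_eq ?_) (hd.norm_le (le_of_eq (abs_of_nonneg hr0)) n)
    simp only [DeltaNLS.derivCoeff, norm_mul, norm_pow, Nat.add_sub_cancel, norm_norm]
    push_cast
    ring
  have hmem : z ∈ Metric.ball (0 : ℝ) r := by simpa using hzr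
  have key := hasDerivAt_tsum_of_isPreconnected (g := fun n y => c n * y ^ n)
    (g' := fun n y => c n * (n * y ^ (n - 1))) (t := Metric.ball 0 r) (y₀ := z) (y := z) hu
    Metric.isOpen_ball (convex_ball _ _).isPreconnected
    (fun n y _ => (hasDerivAt_pow n y).const_mul (c n)) (fun n y hy => by
      have hy' : |y| ≤ r := by simpa using (mem_ball_zero_iff.1 hy).le
      rw [norm_mul, norm_mul, norm_pow, Real.norm_natCast, Real.norm_eq_abs y]
      gcongr) hmem (h.summable hz) hmem
  convert! key using 1
  have hs : Summable fun n : ℕ => c n * (n * z ^ (n - 1)) :=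
    Summable.of_norm_bounded hu fun n => by
      rw [norm_mul, norm_mul, norm_pow, Real.norm_natCast, Real.norm_eq_abs z]
      gcongr
  rw [hs.tsum_eq_zero_add, powerSum]
  simp only [Nat.cast_zero, zero_mul, mul_zero, zero_add, Nat.add_sub_cancel]
  refine tsum_congr fun n => ?_
  simp only [DeltaNLS.derivCoeff]
  push_cast
  ring

theorem PolyGrowth.hasSum_mul (h : PolyGrowth C M c) (hz : |z| < 1) :
    HasSum (fun n : ℕ => (if n = 0 then 0 else c (n - 1)) * z ^ n) (z * powerSum c z) := by
  rw [← hasSum_nat_add_iff' 1]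
  simp only [Finset.range_one, Finset.sum_singleton, if_true, zero_mul, sub_zero]
  have := (h.summable hz).hasSum.mul_left z
  refine this.congr_fun ?_
  intro n
  simp [pow_succ]
  ring

end PowerSeries

/-! ### The hypergeometric series and its equation -/

section Hypergeometric

/-- Coefficients of the hypergeometric function `₂F₁(κ-N, κ+N+1; κ+1; z)`. -/
def hypCoeff (N κ : ℝ) : ℕ → ℝ
  | 0 => 1
  | n + 1 => (κ - N + n) * (κ + N + 1 + n) / ((κ + 1 + n) * (n + 1)) * hypCoeff N κ n

variable {N κ z : ℝ} {M : ℕ}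

theorem hypCoeff_succ_mul (hκ : 0 < κ) (n : ℕ) :
    (κ + 1 + n) * (n + 1) * hypCoeff N κ (n + 1) =
      (κ - N + n) * (κ + N + 1 + n) * hypCoeff N κ n := by
  have h1 : κ + 1 + n ≠ 0 := by positivity
  have h2 : (n + 1 : ℝ) ≠ 0 := by positivity
  rw [hypCoeff]
  field_simp

/-- The ratio of consecutive coefficients is at most (n+M+1)/(n+1), the ratio of consecutive
binomials. As M depends only on an upper bound for κ, the majorant is uniform in κ, which yields
continuity in κ. -/
theorem polyGrowth_hypCoeff (hN : 1 < N) (hκ : N - 1 ≤ κ) (hM : κ + N ≤ M) :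
    PolyGrowth 1 M (hypCoeff N κ) := by
  intro n
  rw [one_mul]
  induction n with
  | zero => simp [hypCoeff]
  | succ n ih =>
    have hκ0 : 0 < κ := by linarith
    have h1 : 0 < κ + 1 + n := by positivity
    have h2 : (0 : ℝ) < n + 1 := by positivity
    have hch : ((n + M).choose M : ℝ) * (n + M + 1) = ((n + 1 + M).choose M : ℝ) * (n + 1) := by
      have := Nat.choose_mul_succ_eq (n + M) M
      rw [show n + M + 1 - M = n + 1 by omega] at this
      rw [show n + 1 + M = n + M + 1 by omega]
      exact_mod_cast this
    have h3 : |κ - N + n| ≤ κ + 1 + n := by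
      rw [abs_le]
      constructor <;> linarith [(Nat.cast_nonneg n : (0 : ℝ) ≤ n)]
    have h4 : |κ + N + 1 + n| ≤ n + M + 1 := by
      rw [abs_of_nonneg (by positivity)]
      linarith
    rw [hypCoeff, abs_mul, abs_div, abs_mul, abs_of_pos (mul_pos h1 h2), div_mul_eq_mul_div,
      div_le_iff₀ (mul_pos h1 h2)]
    calc |κ - N + n| * |κ + N + 1 + n| * |hypCoeff N κ n|
        ≤ (κ + 1 + n) * (n + M + 1) * ((n + M).choose M : ℝ) := by gcongr
      _ = (κ + 1 + n) * (((n + M).choose M : ℝ) * (n + M + 1)) := by ring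
      _ = _ := by rw [hch]; ring

theorem exists_polyGrowth_hypCoeff (hN : 1 < N) (K : ℝ) :
    ∃ M : ℕ, ∀ κ, N - 1 ≤ κ → κ ≤ K → PolyGrowth 1 M (hypCoeff N κ) := by
  obtain ⟨M, hM⟩ := exists_nat_ge (K + N)
  exact ⟨M, fun κ h1 h2 => polyGrowth_hypCoeff hN h1 (by linarith)⟩

theorem continuousOn_hypCoeff (hN : 1 < N) (n : ℕ) :
    ContinuousOn (fun κ => hypCoeff N κ n) (Ici (N - 1)) := by
  induction n with
  | zero => simp only [hypCoeff]; exact continuousOn_const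
  | succ n ih =>
    simp only [hypCoeff]
    refine ContinuousOn.mul (ContinuousOn.div (by fun_prop) (by fun_prop) fun κ hκ => ?_) ih
    have : 0 < κ := lt_of_lt_of_le (by linarith) (mem_Ici.1 hκ)
    positivity

/-- The hypergeometric function `₂F₁(κ-N, κ+N+1; κ+1; z)`. -/
def hyp (N κ z : ℝ) : ℝ := powerSum (hypCoeff N κ) z

/-- The derivative of `hyp` in `z`. -/
def hypDeriv (N κ z : ℝ) : ℝ := powerSum (derivCoeff (hypCoeff N κ)) z

/-- The second derivative of `hyp` in `z`. -/
def hypDeriv₂ (N κ z : ℝ) : ℝ := powerSum (derivCoeff (derivCoeff (hypCoeff N κ))) z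

theorem hasDerivAt_hyp (hN : 1 < N) (hκ : N - 1 ≤ κ) (hz : |z| < 1) :
    HasDerivAt (hyp N κ) (hypDeriv N κ z) z := by
  obtain ⟨M, hM⟩ := exists_polyGrowth_hypCoeff hN κ
  exact (hM κ hκ le_rfl).hasDerivAt hz

theorem hasDerivAt_hypDeriv (hN : 1 < N) (hκ : N - 1 ≤ κ) (hz : |z| < 1) :
    HasDerivAt (hypDeriv N κ) (hypDeriv₂ N κ z) z := by
  obtain ⟨M, hM⟩ := exists_polyGrowth_hypCoeff hN κ
  exact (hM κ hκ le_rfl).derivCoeff.hasDerivAt hz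

theorem continuousOn_powerSum_param {c : ℝ → ℕ → ℝ} {s : Set ℝ} {C : ℝ}
    (hc : ∀ n, ContinuousOn (fun κ => c κ n) s) (hg : ∀ κ ∈ s, PolyGrowth C M (c κ))
    (hz : |z| < 1) : ContinuousOn (fun κ => powerSum (c κ) z) s :=
  continuousOn_tsum (fun n => (hc n).mul continuousOn_const)
    (summable_majorant C M (by rwa [abs_abs])) fun n κ hκ => (hg κ hκ).norm_le le_rfl n

theorem continuousOn_hyp (hN : 1 < N) (K : ℝ) (hz : |z| < 1) :
    ContinuousOn (fun κ => hyp N κ z) (Icc (N - 1) K) := by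
  obtain ⟨M, hM⟩ := exists_polyGrowth_hypCoeff hN K
  exact continuousOn_powerSum_param
    (fun n => (continuousOn_hypCoeff hN n).mono fun κ hκ => hκ.1)
    (fun κ hκ => hM κ hκ.1 hκ.2) hz

theorem continuousOn_hypDeriv (hN : 1 < N) (K : ℝ) (hz : |z| < 1) :
    ContinuousOn (fun κ => hypDeriv N κ z) (Icc (N - 1) K) := by
  obtain ⟨M, hM⟩ := exists_polyGrowth_hypCoeff hN K
  exact continuousOn_powerSum_param
    (fun n => continuousOn_const.mul
      ((continuousOn_hypCoeff hN (n + 1)).mono fun κ hκ => hκ.1))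
    (fun κ hκ => (hM κ hκ.1 hκ.2).derivCoeff) hz

/-- Comparing coefficients of zⁿ leaves the recurrence `hypCoeff_succ_mul`, since (κ-N+n)(κ+N+1+n) =
n(n-1) + 2(κ+1)n + κ(κ+1) - N(N+1). -/
theorem hyp_ode (hN : 1 < N) (hκ : N - 1 ≤ κ) (hz : |z| < 1) :
    z * (1 - z) * hypDeriv₂ N κ z + (κ + 1) * (1 - 2 * z) * hypDeriv N κ z -
      (κ * (κ + 1) - N * (N + 1)) * hyp N κ z = 0 := by
  obtain ⟨M, hM⟩ := exists_polyGrowth_hypCoeff hN κ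
  have g0 := hM κ hκ le_rfl
  have g1 := g0.derivCoeff
  have g2 := g1.derivCoeff
  have s0 := (g0.summable hz).hasSum
  have s1 := (g1.summable hz).hasSum
  have s1' := g1.hasSum_mul hz
  have s2 := g2.hasSum_mul hz
  have s2' : HasSum (fun n : ℕ => (n : ℝ) * (n - 1) * hypCoeff N κ n * z ^ n)
      (z * (z * hypDeriv₂ N κ z)) := by
    rw [← hasSum_nat_add_iff' 1]
    simp only [Finset.range_one, Finset.sum_singleton, Nat.cast_zero, zero_mul, sub_zero]
    refine (s2.mul_left z).congr_fun fun n => ?_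
    rcases n with _ | n
    · simp
    · simp only [derivCoeff, Nat.add_sub_cancel, Nat.succ_ne_zero, if_false]
      push_cast
      ring
  have hsum := (((s2.sub s2').add (s1.mul_left (κ + 1))).sub (s1'.mul_left (2 * (κ + 1)))).sub
    (s0.mul_left (κ * (κ + 1) - N * (N + 1)))
  have hzero : HasSum (fun _ : ℕ => (0 : ℝ)) 0 := hasSum_zero
  have := hsum.unique (hzero.congr_fun fun n => ?_)
  · change z * hypDeriv₂ N κ z - z * (z * hypDeriv₂ N κ z) + (κ + 1) * hypDeriv N κ z -
      2 * (κ + 1) * (z * hypDeriv N κ z) - (κ * (κ + 1) - N * (N + 1)) * hyp N κ z = 0 at this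
    linarith
  · have hrec := hypCoeff_succ_mul (N := N) (show 0 < κ by linarith) n
    rcases n with _ | n
    · simp only [derivCoeff, if_true, Nat.cast_zero, zero_mul, sub_zero, zero_add, pow_zero,
        mul_one, add_zero, mul_zero, one_mul] at hrec ⊢
      linarith
    · simp only [derivCoeff, Nat.add_sub_cancel, Nat.succ_ne_zero, if_false]
      push_cast at hrec ⊢
      linear_combination z ^ (n + 1) * hrec

end Hypergeometric

/-! ### The decaying solution and its boundary conditions -/

section Hypergeometric

variable {N κ z b y : ℝ}

theorem powerSum_eq_zero_of_coeff {c : ℕ → ℝ} (h : ∀ n, c n = 0) : powerSum c z = 0 := by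
  simp [powerSum, h]

/-- At κ = N the series stops at its constant term, and at κ = N-1 at its linear term. These
explicit values supply signs for the intermediate value arguments. -/
theorem hypCoeff_self (N : ℝ) (n : ℕ) : hypCoeff N N (n + 1) = 0 := by
  induction n with
  | zero => simp [hypCoeff]
  | succ n ih => rw [hypCoeff, ih, mul_zero]

theorem hypCoeff_sub_one (hN : 1 < N) : hypCoeff N (N - 1) 1 = -2 := by
  have : N ≠ 0 := by positivity
  simp only [hypCoeff, Nat.cast_zero, add_zero, sub_add_cancel, zero_add, mul_one]
  rw [div_eq_iff this]
  ring

theorem hypCoeff_sub_one_add_two (N : ℝ) (n : ℕ) : hypCoeff N (N - 1) (n + 2) = 0 := by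
  induction n with
  | zero => rw [hypCoeff]; simp
  | succ n ih => rw [hypCoeff, ih, mul_zero]

theorem hyp_self : hyp N N z = 1 := by
  rw [hyp, powerSum, tsum_eq_single 0 fun n hn => ?_]
  · simp [hypCoeff]
  · obtain ⟨n, rfl⟩ := Nat.exists_eq_succ_of_ne_zero hn
    rw [hypCoeff_self, zero_mul]

theorem hypDeriv_self : hypDeriv N N z = 0 :=
  powerSum_eq_zero_of_coeff fun n => by rw [derivCoeff, hypCoeff_self, mul_zero]

theorem hyp_sub_one (hN : 1 < N) : hyp N (N - 1) z = 1 - 2 * z := by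
  rw [hyp, powerSum, tsum_eq_sum (s := Finset.range 2) fun n hn => ?_]
  · rw [Finset.sum_range_succ, Finset.sum_range_one, hypCoeff_sub_one hN]
    simp [hypCoeff]
    ring
  · obtain ⟨n, rfl⟩ := Nat.exists_eq_add_of_le' (not_lt.1 fun h => hn (Finset.mem_range.2 h))
    rw [hypCoeff_sub_one_add_two, zero_mul]

theorem hyp_zero : hyp N κ 0 = 1 := by
  rw [hyp, powerSum, tsum_eq_single 0 fun n hn => by simp [hn]]
  simp [hypCoeff]

theorem hyp_pos (hN : 1 < N) (hκ : N ≤ κ) (hz0 : 0 ≤ z) (hz1 : z < 1) : 0 < hyp N κ z := by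
  have hnn : ∀ n, 0 ≤ hypCoeff N κ n := by
    intro n
    induction n with
    | zero => simp [hypCoeff]
    | succ n ih =>
      rw [hypCoeff]
      have h1 : 0 ≤ κ - N := sub_nonneg.2 hκ
      have h2 : 0 < κ := by linarith
      positivity
  obtain ⟨M, hM⟩ := exists_polyGrowth_hypCoeff hN κ
  have hs := (hM κ (by linarith) le_rfl).summable (z := z) (by rwa [abs_of_nonneg hz0])
  have := hs.le_tsum 0 fun n _ => mul_nonneg (hnn n) (pow_nonneg hz0 n)
  simp only [hypCoeff, pow_zero, mul_one] at this
  exact one_pos.trans_le this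

/-- The decaying solution of `u'' = (κ² - N(N+1) sech²) u`. -/
def jost (N κ y : ℝ) : ℝ := Real.cosh y ^ (-κ) * hyp N κ ((1 - Real.tanh y) / 2)

/-- The derivative of `jost`. -/
def jostDeriv (N κ y : ℝ) : ℝ :=
  Real.cosh y ^ (-κ) * (-κ * Real.tanh y * hyp N κ ((1 - Real.tanh y) / 2) -
    (1 - Real.tanh y ^ 2) / 2 * hypDeriv N κ ((1 - Real.tanh y) / 2))

theorem tanh_arg_pos (y : ℝ) : 0 < (1 - Real.tanh y) / 2 := by
  linarith [Real.tanh_lt_one y]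

theorem tanh_arg_lt_one (y : ℝ) : (1 - Real.tanh y) / 2 < 1 := by
  linarith [Real.neg_one_lt_tanh y]

theorem abs_tanh_arg_lt_one (y : ℝ) : |(1 - Real.tanh y) / 2| < 1 := by
  rw [abs_of_pos (tanh_arg_pos y)]
  exact tanh_arg_lt_one y

theorem hasDerivAt_tanh_arg (y : ℝ) :
    HasDerivAt (fun y => (1 - Real.tanh y) / 2) (-(1 - Real.tanh y ^ 2) / 2) y := by
  exact ((hasDerivAt_tanh y).const_sub 1).div_const 2

theorem hasDerivAt_cosh_rpow (κ y : ℝ) :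
    HasDerivAt (fun y => Real.cosh y ^ (-κ)) (Real.cosh y ^ (-κ) * (-κ * Real.tanh y)) y := by
  refine ((Real.hasDerivAt_cosh y).rpow_const (Or.inl (Real.cosh_pos y).ne')).congr_deriv ?_
  rw [Real.rpow_sub_one (Real.cosh_pos y).ne', Real.tanh_eq_sinh_div_cosh]
  ring

theorem hasDerivAt_jost (hN : 1 < N) (hκ : N - 1 ≤ κ) (y : ℝ) :
    HasDerivAt (jost N κ) (jostDeriv N κ y) y := by
  have h1 := (hasDerivAt_hyp hN hκ (abs_tanh_arg_lt_one y)).comp y (hasDerivAt_tanh_arg y)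
  refine ((hasDerivAt_cosh_rpow κ y).fun_mul h1).congr_deriv ?_
  simp only [jostDeriv, Function.comp]
  ring

/-- With z = (1 - tanh y)/2 one has z(1-z) = (1 - tanh² y)/4, which turns the hypergeometric
equation into the Schrödinger equation. -/
theorem hasDerivAt_jostDeriv (hN : 1 < N) (hκ : N - 1 ≤ κ) (y : ℝ) :
    HasDerivAt (jostDeriv N κ) ((κ ^ 2 - N * (N + 1) * (1 - Real.tanh y ^ 2)) * jost N κ y) y := by
  have h1 := (hasDerivAt_hyp hN hκ (abs_tanh_arg_lt_one y)).comp y (hasDerivAt_tanh_arg y)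
  have h2 := (hasDerivAt_hypDeriv hN hκ (abs_tanh_arg_lt_one y)).comp y (hasDerivAt_tanh_arg y)
  have ht := hasDerivAt_tanh y
  have h3 := ((ht.const_mul (-κ)).fun_mul h1).fun_sub
    ((((ht.fun_pow 2).const_sub 1).div_const 2).fun_mul h2)
  refine ((hasDerivAt_cosh_rpow κ y).fun_mul h3).congr_deriv ?_
  have hode := hyp_ode hN hκ (abs_tanh_arg_lt_one y)
  simp only [jost, Function.comp, Nat.cast_ofNat, Nat.reduceSub, pow_one]
  set t := Real.tanh y
  set F := hyp N κ ((1 - t) / 2)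
  set F' := hypDeriv N κ ((1 - t) / 2)
  set F'' := hypDeriv₂ N κ ((1 - t) / 2)
  linear_combination (Real.cosh y ^ (-κ) * (1 - t ^ 2)) * hode

theorem cosh_rpow_le (hκ : 0 ≤ κ) (y : ℝ) :
    Real.cosh y ^ (-κ) ≤ 2 ^ κ * Real.exp (-κ * y) := by
  have h1 : Real.exp y / 2 ≤ Real.cosh y := by
    rw [Real.cosh_eq]
    linarith [Real.exp_pos (-y)]
  have h2 : (0 : ℝ) < Real.exp y / 2 := by positivity
  refine (Real.rpow_le_rpow_of_nonpos h2 h1 (neg_nonpos.2 hκ)).trans (le_of_eq ?_)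
  rw [Real.div_rpow (Real.exp_pos y).le zero_le_two, ← Real.exp_mul, Real.rpow_neg zero_le_two,
    div_inv_eq_mul, mul_comm (2 ^ κ), mul_comm y]

theorem strictMono_tanh : StrictMono Real.tanh :=
  strictMono_of_hasDerivAt_pos hasDerivAt_tanh fun x => by linarith [Real.tanh_sq_lt_one x]

/-- For y ≥ b the hypergeometric argument stays in a compact subset of [0, 1), where the series and
its derivative are bounded; the power of cosh supplies the decay. -/
theorem exists_jost_le (hN : 1 < N) (hκ : N - 1 ≤ κ) (b : ℝ) :
    ∃ C, ∀ y, b ≤ y → |jost N κ y| ≤ C * Real.exp (-κ * y) ∧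
      |jostDeriv N κ y| ≤ C * Real.exp (-κ * y) := by
  have hκ0 : 0 < κ := by linarith
  have hsub : ∀ z ∈ Icc (0 : ℝ) ((1 - Real.tanh b) / 2), |z| < 1 := fun z hz => by
    rw [abs_of_nonneg hz.1]
    exact hz.2.trans_lt (tanh_arg_lt_one b)
  obtain ⟨A, hA⟩ := isCompact_Icc.exists_bound_of_continuousOn (f := hyp N κ)
    (s := Icc 0 ((1 - Real.tanh b) / 2))
    (fun z hz => (hasDerivAt_hyp hN hκ (hsub z hz)).continuousAt.continuousWithinAt)
  obtain ⟨B, hB⟩ := isCompact_Icc.exists_bound_of_continuousOn (f := hypDeriv N κ)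
    (s := Icc 0 ((1 - Real.tanh b) / 2))
    (fun z hz => (hasDerivAt_hypDeriv hN hκ (hsub z hz)).continuousAt.continuousWithinAt)
  have hcosh := cosh_rpow_le hκ0.le
  have hpos : ∀ y, 0 < Real.cosh y ^ (-κ) := fun y => Real.rpow_pos_of_pos (Real.cosh_pos y) _
  have main : ∀ (D E y : ℝ), |E| ≤ D → D ≤ A + κ * A + B →
      |Real.cosh y ^ (-κ) * E| ≤ 2 ^ κ * (A + κ * A + B) * Real.exp (-κ * y) := by
    intro D E y h1 h2
    rw [abs_mul, abs_of_pos (hpos y)]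
    calc Real.cosh y ^ (-κ) * |E| ≤ (2 ^ κ * Real.exp (-κ * y)) * (A + κ * A + B) :=
          mul_le_mul (hcosh y) (h1.trans h2) (abs_nonneg _) (by positivity)
      _ = _ := by ring
  refine ⟨2 ^ κ * (A + κ * A + B), fun y hy => ?_⟩
  have hmem : (1 - Real.tanh y) / 2 ∈ Icc 0 ((1 - Real.tanh b) / 2) :=
    ⟨(tanh_arg_pos y).le, by linarith [strictMono_tanh.monotone hy]⟩
  have hAy := hA _ hmem
  have hBy := hB _ hmem
  rw [Real.norm_eq_abs] at hAy hBy
  have hA0 : 0 ≤ A := (abs_nonneg _).trans hAy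
  have hB0 : 0 ≤ B := (abs_nonneg _).trans hBy
  refine ⟨main A _ y hAy (by nlinarith), main (κ * A + B) _ y ?_ (by linarith)⟩
  refine (abs_sub _ _).trans (add_le_add ?_ ?_)
  · rw [abs_mul, abs_mul, abs_neg, abs_of_pos hκ0]
    have := (Real.abs_tanh_lt_one y).le
    calc κ * |Real.tanh y| * _ ≤ κ * 1 * A := by gcongr
      _ = κ * A := by ring
  · rw [abs_mul]
    have h1 : |(1 - Real.tanh y ^ 2) / 2| ≤ 1 := by
      rw [abs_of_nonneg (by linarith [Real.tanh_sq_lt_one y])]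
      linarith [sq_nonneg (Real.tanh y)]
    calc _ ≤ 1 * B := by gcongr
      _ = B := one_mul B

/-- The hypergeometric factor is tanh b < 0 at κ = N-1 and 1 at κ = N. This Dirichlet root produces
the odd eigenfunction. -/
theorem exists_jost_eq_zero (hN : 1 < N) (hb : Real.tanh b < 0) :
    ∃ κ, N - 1 < κ ∧ κ < N ∧ jost N κ b = 0 := by
  have hc := continuousOn_hyp hN N (abs_tanh_arg_lt_one b)
  obtain ⟨κ, hκ, h⟩ := intermediate_value_Ioo (by linarith) hc
    (show (0 : ℝ) ∈ Ioo _ _ by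
      simp only [hyp_sub_one hN, hyp_self]
      exact ⟨by linarith, one_pos⟩)
  exact ⟨κ, hκ.1, hκ.2, by simp only [jost]; simp only at h; rw [h, mul_zero]⟩

/-- For such κ both the solution and its potential are nonnegative, so the derivative is increasing;
it tends to 0 at infinity. -/
theorem jostDeriv_nonpos (hN : 1 < N) (hκ : N ≤ κ) (hκ2 : N * (N + 1) ≤ κ ^ 2) (y : ℝ) :
    jostDeriv N κ y ≤ 0 := by
  have hmono : Monotone (jostDeriv N κ) := by
    refine monotone_of_hasDerivAt_nonneg (hasDerivAt_jostDeriv hN (by linarith)) fun x => ?_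
    refine mul_nonneg ?_ (mul_nonneg (Real.rpow_pos_of_pos (Real.cosh_pos x) _).le
      (hyp_pos hN hκ (tanh_arg_pos x).le (tanh_arg_lt_one x)).le)
    have h1 : 0 ≤ N * (N + 1) := by positivity
    nlinarith [sq_nonneg (Real.tanh x)]
  obtain ⟨C, hC⟩ := exists_jost_le hN (by linarith : N - 1 ≤ κ) 0
  refine hmono.ge_of_tendsto ?_ y
  refine squeeze_zero_norm' (a := fun x => C * Real.exp (-κ * x)) ?_ ?_
  · filter_upwards [eventually_ge_atTop 0] with x hx
    exact (hC x hx).2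
  · have : Tendsto (fun x : ℝ => -κ * x) atTop atBot :=
      tendsto_id.const_mul_atTop_of_neg (by linarith)
    simpa using (Real.tendsto_exp_atBot.comp this).const_mul C

/-- The Robin condition is the jump condition of an even eigenfunction. After division by the power
of cosh, its left side is -tanh b > 0 at κ = N and negative at κ = √(N(N+1)), where the solution is
positive and nonincreasing. -/
theorem exists_jost_robin (hN : 1 < N) (hb : Real.tanh b < 0) :
    ∃ κ, N < κ ∧ jostDeriv N κ b + (N - 1) * Real.tanh b * jost N κ b = 0 := by
  have hcp : ∀ κ : ℝ, 0 < Real.cosh b ^ (-κ) := fun κ => Real.rpow_pos_of_pos (Real.cosh_pos b) _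
  set z := (1 - Real.tanh b) / 2 with hz
  set G : ℝ → ℝ := fun κ => (-κ + (N - 1)) * Real.tanh b * hyp N κ z -
    (1 - Real.tanh b ^ 2) / 2 * hypDeriv N κ z with hG
  have hGeq : ∀ κ, jostDeriv N κ b + (N - 1) * Real.tanh b * jost N κ b =
      Real.cosh b ^ (-κ) * G κ := fun κ => by
    simp only [jost, jostDeriv, hG]
    ring
  have hNpos : 0 < N * (N + 1) := by positivity
  set K := √(N * (N + 1)) with hK
  have hKsq : K ^ 2 = N * (N + 1) := Real.sq_sqrt hNpos.le
  have hNK : N ≤ K := Real.le_sqrt_of_sq_le (by nlinarith)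
  have hc : ContinuousOn G (Icc N K) := by
    have h1 := (continuousOn_hyp hN K (abs_tanh_arg_lt_one b)).mono
      (Icc_subset_Icc_left (by linarith : N - 1 ≤ N))
    have h2 := (continuousOn_hypDeriv hN K (abs_tanh_arg_lt_one b)).mono
      (Icc_subset_Icc_left (by linarith : N - 1 ≤ N))
    exact ContinuousOn.sub (ContinuousOn.mul (by fun_prop) h1) (continuousOn_const.mul h2)
  have hGK : G K < 0 := by
    have h1 := jostDeriv_nonpos hN hNK hKsq.ge b
    have h2 : 0 < jost N K b := mul_pos (hcp K) (hyp_pos hN hNK (tanh_arg_pos b).le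
      (tanh_arg_lt_one b))
    have h3 : (N - 1) * Real.tanh b * jost N K b < 0 :=
      mul_neg_of_neg_of_pos (mul_neg_of_pos_of_neg (by linarith) hb) h2
    by_contra hcon
    have := mul_nonneg (hcp K).le (not_lt.1 hcon)
    rw [← hGeq] at this
    linarith
  obtain ⟨κ, hκ, h⟩ := intermediate_value_Ioo' hNK hc
    (show (0 : ℝ) ∈ Ioo _ _ from ⟨hGK, by simp only [hG, hyp_self, hypDeriv_self]; linarith⟩)
  exact ⟨κ, hκ.1, by rw [hGeq, h, mul_zero]⟩

/-- Large y corresponds to small hypergeometric argument, where the series is close to 1. -/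
theorem exists_jost_ne_zero (hN : 1 < N) (hκ : N - 1 ≤ κ) (b : ℝ) :
    ∃ y, b < y ∧ jost N κ y ≠ 0 := by
  have hc : ContinuousAt (hyp N κ) 0 := (hasDerivAt_hyp hN hκ (by simp)).continuousAt
  have hne : ∀ᶠ z in 𝓝 (0 : ℝ), hyp N κ z ≠ 0 := hc.eventually_ne (by simp [hyp_zero])
  have hlt : ∀ᶠ z in 𝓝 (0 : ℝ), z < (1 - Real.tanh b) / 2 := gt_mem_nhds (tanh_arg_pos b)
  obtain ⟨z, ⟨hz1, hz2⟩, hz0⟩ := (((hne.and hlt).filter_mono nhdsWithin_le_nhds).and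
    (self_mem_nhdsWithin (s := Ioi (0 : ℝ)))).exists
  have hz0' : 0 < z := hz0
  have hmem : 1 - 2 * z ∈ Ioo (-1 : ℝ) 1 := ⟨by linarith [tanh_arg_lt_one b], by linarith⟩
  refine ⟨Real.artanh (1 - 2 * z), ?_, ?_⟩
  · rw [← strictMono_tanh.lt_iff_lt, Real.tanh_artanh hmem]
    linarith
  · rw [jost, Real.tanh_artanh hmem, show (1 - (1 - 2 * z)) / 2 = z by ring]
    exact mul_ne_zero (Real.rpow_pos_of_pos (Real.cosh_pos _) _).ne' hz1

end Hypergeometric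

/-! ### Eigenfunctions by even and odd reflection -/

theorem memLp_exp_neg_abs {k : ℝ} (hk : 0 < k) :
    MemLp (fun x : ℝ => Real.exp (-k * |x|)) 2 volume := by
  rw [memLp_two_iff_integrable_sq (by fun_prop)]
  have h : Integrable (fun x : ℝ => Real.exp (-(2 * k) * |x|)) := by
    rw [← integrableOn_univ, ← Iic_union_Ioi (a := (0 : ℝ)), integrableOn_union]
    constructor
    · refine (integrableOn_exp_mul_Iic (a := 2 * k) (by positivity) 0).congr_fun (fun x hx => ?_)
        measurableSet_Iic
      simp only [abs_of_nonpos (mem_Iic.1 hx), neg_mul_neg]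
    · refine (integrableOn_exp_mul_Ioi (a := -(2 * k)) (by linarith) 0).congr_fun (fun x hx => ?_)
        measurableSet_Ioi
      simp only [abs_of_pos (mem_Ioi.1 hx)]
  refine h.congr (ae_of_all _ fun x => ?_)
  simp only
  rw [← Real.exp_nat_mul]
  push_cast
  ring_nf

/-- Extension of a function on the half line to the line, even for `σ = 1`, odd for `σ = -1`. -/
def reflectExt (σ : ℝ) (w : ℝ → ℝ) (x : ℝ) : ℝ := if x ≤ 0 then σ * w (-x) else w x

theorem reflectExt_of_pos {σ x : ℝ} {w : ℝ → ℝ} (hx : 0 < x) : reflectExt σ w x = w x :=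
  if_neg (not_le.2 hx)

theorem reflectExt_neg_of_pos {σ x : ℝ} {w : ℝ → ℝ} (hx : 0 < x) :
    reflectExt σ w (-x) = σ * w x := by
  rw [reflectExt, if_pos (by linarith), neg_neg]

theorem memLp_reflectExt {σ C k : ℝ} {w : ℝ → ℝ} (hw : Continuous w) (hk : 0 < k)
    (hC : ∀ x, 0 ≤ x → |w x| ≤ C * Real.exp (-k * x)) : MemLp (reflectExt σ w) 2 volume := by
  have hC0 : 0 ≤ C := by simpa using (abs_nonneg _).trans (hC 0 le_rfl)
  have hm : Measurable (reflectExt σ w) := Measurable.ite measurableSet_Iic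
    (measurable_const.mul (hw.measurable.comp measurable_neg)) hw.measurable
  refine ((memLp_exp_neg_abs hk).const_mul ((1 + |σ|) * C)).of_le hm.aestronglyMeasurable
    (ae_of_all _ fun x => ?_)
  have e : |(1 + |σ|) * C * Real.exp (-k * |x|)| = (1 + |σ|) * (C * Real.exp (-k * |x|)) := by
    rw [abs_of_nonneg (by positivity), mul_assoc]
  rw [Real.norm_eq_abs, Real.norm_eq_abs, e]
  rcases le_or_gt x 0 with hx | hx
  · rw [reflectExt, if_pos hx, abs_mul, abs_of_nonpos hx]
    have h := hC (-x) (by linarith)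
    gcongr
    linarith
  · rw [reflectExt_of_pos hx, abs_of_pos hx]
    have h := hC x hx.le
    have : 0 ≤ |σ| * (C * Real.exp (-k * x)) := by positivity
    linarith

section Construct

variable {ω γ μ σ C k : ℝ} {V : ℝ →ᵇ ℝ} {w w' q : ℝ → ℝ}

theorem isOffDiff_reflectExt (hw : ∀ x, HasDerivAt w (w' x) x) (hw' : Continuous w') (hk : 0 < k)
    (hC : ∀ x, 0 ≤ x → |w x| ≤ C * Real.exp (-k * x))
    (hC' : ∀ x, 0 ≤ x → |w' x| ≤ C * Real.exp (-k * x)) (h0 : σ * w 0 = w 0) :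
    IsOffDiff (reflectExt σ w) (reflectExt (-σ) w') where
  continuous := by
    have hwc : Continuous w := continuous_iff_continuousAt.2 fun x => (hw x).continuousAt
    refine Continuous.if_le (by fun_prop) hwc continuous_id continuous_const fun x hx => ?_
    obtain rfl : x = 0 := hx
    simp [h0]
  hasDerivAt x hx := by
    rcases lt_or_gt_of_ne hx with h | h
    · have h1 : HasDerivAt (fun y => σ * w (-y)) (σ * (w' (-x) * -1)) x :=
        ((hw (-x)).comp x (hasDerivAt_neg x)).const_mul σ
      rw [reflectExt, if_pos h.le]
      refine (h1.congr_deriv (by ring)).congr_of_eventuallyEq ?_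
      filter_upwards [Iio_mem_nhds h] with y hy
      exact if_pos (le_of_lt hy)
    · rw [reflectExt_of_pos h]
      refine (hw x).congr_of_eventuallyEq ?_
      filter_upwards [Ioi_mem_nhds h] with y hy
      exact reflectExt_of_pos hy
  memLp := memLp_reflectExt (continuous_iff_continuousAt.2 fun x => (hw x).continuousAt) hk hC
  memLp_deriv := memLp_reflectExt hw' hk hC'

/-- One statement covers both parities. For σ = 1, `h0` is automatic and `hjump` is the Robin
condition; for σ = -1, `h0` forces w(0) = 0 and `hjump` follows. Integration by parts on each half
line leaves only the boundary terms that `hjump` balances. -/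
theorem exists_mem_graph_of_halfLine (hw : ∀ x, HasDerivAt w (w' x) x)
    (hw' : ∀ x, HasDerivAt w' (q x * w x) x) (hq : Continuous q) (hk : 0 < k)
    (hC : ∀ x, 0 ≤ x → |w x| ≤ C * Real.exp (-k * x))
    (hC' : ∀ x, 0 ≤ x → |w' x| ≤ C * Real.exp (-k * x)) (h0 : σ * w 0 = w 0)
    (hjump : (1 + σ) * w' 0 = -γ * w 0)
    (hV : ∀ x, ω - V x - μ = q |x|) (hne : ∃ x, 0 < x ∧ w x ≠ 0) :
    eigenspace (formOperator ω γ V) μ ≠ ⊥ := by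
  have hwc : Continuous w := continuous_iff_continuousAt.2 fun x => (hw x).continuousAt
  have hwc' : Continuous w' := continuous_iff_continuousAt.2 fun x => (hw' x).continuousAt
  have hv := isOffDiff_reflectExt hw hwc' hk hC hC' h0
  set v := reflectExt σ w with hvdef
  set d := reflectExt (-σ) w' with hddef
  have hv0 : v 0 = w 0 := by simp [hvdef, reflectExt, h0]
  set x : L2R := hv.memLp.toLp v with hx
  have hvx : v =ᵐ[volume] x := hv.memLp.coeFn_toLp.symm
  refine Submodule.ne_bot_iff _ |>.2 ⟨x, mem_eigenspace_formOperator.2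
    ⟨v, d, hv.isH1, hvx, fun z z' hz => ?_⟩, fun hx0 => ?_⟩
  · have hzr := hz.comp_neg
    have Ivz : Integrable (fun t => v t * z t) := integrable_mul_of_memLp hv.memLp hz.memLp
    have IVvz : Integrable (fun t => V t * v t * z t) :=
      integrable_potential_mul V hv.memLp hz.memLp
    have Idz : Integrable (fun t => d t * z' t) :=
      integrable_mul_of_memLp hv.memLp_deriv hz.memLp_deriv
    have IQ : Integrable (fun t => (ω - V t - μ) * v t * z t) := by
      have : Integrable (fun t => (ω * (v t * z t) - V t * v t * z t) - μ * (v t * z t)) :=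
        ((Ivz.const_mul ω).sub IVvz).sub (Ivz.const_mul μ)
      refine this.congr (ae_of_all _ fun t => ?_)
      simp only
      ring
    have half : ∀ {y y' : ℝ → ℝ}, IsH1 y y' →
        ∫ t in Ioi (0 : ℝ), w' t * y' t = -(w' 0 * y 0) - ∫ t in Ioi (0 : ℝ), q t * w t * y t := by
      intro y y' hy
      refine integral_Ioi_mul_deriv_of_isH1 hw' (hq.mul hwc) hy ?_ ?_ ?_
      · refine IntegrableOn.congr_fun (f := fun t => d t * y' t)
          (integrable_mul_of_memLp hv.memLp_deriv hy.memLp_deriv).integrableOn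
          (fun t ht => ?_) measurableSet_Ioi
        simp only [hddef, reflectExt_of_pos (mem_Ioi.1 ht)]
      · have : Integrable (fun t => ((ω - μ) * (v t * y t) - V t * v t * y t)) :=
          ((integrable_mul_of_memLp hv.memLp hy.memLp).const_mul _).sub
            (integrable_potential_mul V hv.memLp hy.memLp)
        refine this.integrableOn.congr_fun (fun t ht => ?_) measurableSet_Ioi
        have h1 := hV t
        rw [abs_of_pos (mem_Ioi.1 ht)] at h1
        simp only [← h1, hvdef, reflectExt_of_pos (mem_Ioi.1 ht)]
        ring
      · refine IntegrableOn.congr_fun (f := fun t => d t * y t)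
          (integrable_mul_of_memLp hv.memLp_deriv hy.memLp).integrableOn
          (fun t ht => ?_) measurableSet_Ioi
        simp only [hddef, reflectExt_of_pos (mem_Ioi.1 ht)]
    have hd : ∫ t, d t * z' t =
        (∫ t in Ioi (0 : ℝ), w' t * z' t) + σ * ∫ t in Ioi (0 : ℝ), w' t * -z' (-t) := by
      rw [integral_eq_add_integral_Ioi Idz, ← integral_const_mul]
      congr 1
      · refine setIntegral_congr_fun measurableSet_Ioi fun t ht => ?_
        simp only [hddef, reflectExt_of_pos (mem_Ioi.1 ht)]
      · refine setIntegral_congr_fun measurableSet_Ioi fun t ht => ?_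
        simp only [hddef, reflectExt_neg_of_pos (mem_Ioi.1 ht)]
        ring
    have hQ : ∫ t, (ω - V t - μ) * v t * z t =
        (∫ t in Ioi (0 : ℝ), q t * w t * z t) + σ * ∫ t in Ioi (0 : ℝ), q t * w t * z (-t) := by
      rw [integral_eq_add_integral_Ioi IQ, ← integral_const_mul]
      congr 1
      · refine setIntegral_congr_fun measurableSet_Ioi fun t ht => ?_
        simp only [hvdef, hV, abs_of_pos (mem_Ioi.1 ht), reflectExt_of_pos (mem_Ioi.1 ht)]
      · refine setIntegral_congr_fun measurableSet_Ioi fun t ht => ?_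
        simp only [hvdef, hV, abs_neg, abs_of_pos (mem_Ioi.1 ht),
          reflectExt_neg_of_pos (mem_Ioi.1 ht)]
        ring
    have hQ' : ∫ t, (ω - V t - μ) * v t * z t =
        ω * (∫ t, v t * z t) - (∫ t, V t * v t * z t) - μ * ∫ t, v t * z t := by
      have i1 : Integrable (fun t => ω * (v t * z t) - V t * v t * z t) :=
        (Ivz.const_mul ω).sub IVvz
      rw [← integral_const_mul, ← integral_const_mul, ← integral_sub (Ivz.const_mul ω) IVvz,
        ← integral_sub i1 (Ivz.const_mul μ)]
      refine integral_congr_ae (ae_of_all _ fun t => ?_)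
      simp only
      ring
    have hr : ∫ t, (μ • x : L2R) t * z t = μ * ∫ t, v t * z t := by
      rw [← integral_const_mul]
      refine integral_congr_ae ?_
      filter_upwards [hvx, Lp.coeFn_smul μ x] with t h1 h2
      rw [h2, Pi.smul_apply, smul_eq_mul, ← h1, mul_assoc]
    have e1 := half hz
    have e2 := half hzr
    rw [neg_zero] at e2
    change bilinForm ω γ V v d z z' = ∫ t, (μ • x : L2R) t * z t
    rw [hr, bilinForm, hv0, hd, e1, e2]
    linear_combination hQ - hQ' - z 0 * hjump
  · obtain ⟨y, hy, hwy⟩ := hne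
    have : v = 0 := by
      refine (Continuous.ae_eq_iff_eq (volume : Measure ℝ) hv.continuous continuous_const).1 ?_
      rw [hx0] at hvx
      exact hvx.trans (Lp.coeFn_zero ℝ 2 volume)
    refine hwy ?_
    rw [← reflectExt_of_pos (σ := σ) (w := w) hy]
    exact congrFun this y

end Construct

/-! ### Counting the negative eigenvalues -/

section Spectrum

variable {ω γ μ ν a b N : ℝ} {V : ℝ →ᵇ ℝ}

theorem inner_eq_zero_of_graph {x y : L2R} (hx : (x, μ • x) ∈ formGraph ω γ V)
    (hy : (y, ν • y) ∈ formGraph ω γ V) (hne : μ ≠ ν) : ⟪x, y⟫_ℝ = 0 := by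
  have h := inner_formGraph_symm hx hy
  simp only [inner_smul_left, inner_smul_right, conj_trivial] at h
  have : (μ - ν) * ⟪x, y⟫_ℝ = 0 := by linarith
  exact (mul_eq_zero.1 this).resolve_left (sub_ne_zero.2 hne)

theorem eigenspace_eq_bot_of_ground (hγ : γ = 2 * a * (N - 1) * Real.tanh b)
    (hV : ∀ x, ω - V x = wellPotential a b N (N * (N - 1)) x) (hμ : μ < 0) :
    eigenspace (formOperator ω γ V) μ = ⊥ := by
  refine (Submodule.eq_bot_iff _).2 fun x hx => ?_
  have hg := mem_eigenspace_formOperator.1 hx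
  obtain ⟨v, e, hv, hvx⟩ := exists_isDeltaSol_of_mem_graph hg
  have h1 := energy_eq_inner hg hv.isOffDiff hvx
  have h2 := energy_nonneg_of_ground (a := a) (b := b) (N := N) hv.isOffDiff (by
    simpa only [hV] using integrable_sub_mul_sq (ω := ω) (V := V) hv.memLp)
  simp only [hV] at h1
  rw [← hγ, h1, inner_smul_left, real_inner_self_eq_norm_sq, conj_trivial] at h2
  have : ‖x‖ ^ 2 ≤ 0 := by
    by_contra hcon
    exact absurd h2 (not_le.2 (mul_neg_of_neg_of_pos hμ (not_le.1 hcon)))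
  exact norm_eq_zero.1 (pow_eq_zero_iff two_ne_zero |>.1 (le_antisymm this (sq_nonneg _)))

theorem exists_combination_eq_zero (A B : Fin 3 → ℝ) :
    ∃ α : Fin 3 → ℝ, α ≠ 0 ∧ α 0 * A 0 + α 1 * A 1 + α 2 * A 2 = 0 ∧
      α 0 * B 0 + α 1 * B 1 + α 2 * B 2 = 0 := by
  have hker := LinearMap.ker_ne_bot_of_finrank_lt
    (f := (Matrix.of ![A, B]).mulVecLin) (by simp)
  obtain ⟨α, hα, hα0⟩ := Submodule.exists_mem_ne_zero_of_ne_bot hker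
  rw [LinearMap.mem_ker, Matrix.mulVecLin_apply] at hα
  have h0 := congrFun hα 0
  have h1 := congrFun hα 1
  simp only [Matrix.mulVec, dotProduct, Fin.sum_univ_three, Matrix.of_apply, Matrix.cons_val_zero,
    Matrix.cons_val_one, Pi.zero_apply] at h0 h1
  exact ⟨α, hα0, by linarith, by linarith⟩

/-- Otherwise some nonzero combination of three orthogonal eigenfunctions vanishes at both nodes.
Its energy is nonnegative by `energy_nonneg_of_nodes`, yet equals a negative weighted sum of squared
norms. -/
theorem eigenspace_eq_bot_of_nodes (ha : 0 < a) (hb : b < 0)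
    (hγ : γ = 2 * a * (N - 1) * Real.tanh b)
    (hV : ∀ x, ω - V x = wellPotential a b N (N * (N + 1)) x) {μ : Fin 3 → ℝ}
    (hμ : ∀ i, μ i < 0) (hinj : Function.Injective μ) :
    ∃ i, eigenspace (formOperator ω γ V) (μ i) = ⊥ := by
  by_contra! hcon
  choose x hx hx0 using fun i => Submodule.exists_mem_ne_zero_of_ne_bot (hcon i)
  have hg := fun i => mem_eigenspace_formOperator.1 (hx i)
  choose v e hv hvx using fun i => exists_isDeltaSol_of_mem_graph (hg i)
  obtain ⟨α, hα0, hA, hB⟩ := exists_combination_eq_zero (fun i => v i (-b / a))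
    (fun i => v i (-(-b / a)))
  have hd := fun i => (hv i).isOffDiff.smul (α i)
  have hs := ((hd 0).add (hd 1)).add (hd 2)
  have hgs := add_mem (add_mem ((formGraph ω γ V).smul_mem (α 0) (hg 0))
    ((formGraph ω γ V).smul_mem (α 1) (hg 1))) ((formGraph ω γ V).smul_mem (α 2) (hg 2))
  have hvs : (α 0 • v 0 + α 1 • v 1 + α 2 • v 2) =ᵐ[volume]
      (α 0 • x 0 + α 1 • x 1 + α 2 • x 2 : L2R) := by
    have h := fun i => ((hvx i).const_smul (α i)).trans (Lp.coeFn_smul (α i) (x i)).symm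
    exact ((((h 0).add (h 1)).trans (Lp.coeFn_add _ _).symm).add (h 2)).trans
      (Lp.coeFn_add _ _).symm
  have h1 := energy_eq_inner hgs hs hvs
  have h2 := energy_nonneg_of_nodes (a := a) (b := b) (N := N) hs ha hb
    (by simpa using hA) (by simpa using hB)
    (by simpa only [hV] using integrable_sub_mul_sq (ω := ω) (V := V) hs.memLp)
  simp only [hV] at h1
  rw [← hγ, h1] at h2
  have ho : ∀ i j, i ≠ j → ⟪x i, x j⟫_ℝ = 0 := fun i j hij =>
    inner_eq_zero_of_graph (hg i) (hg j) (hinj.ne hij)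
  have h3 : 0 ≤ μ 0 * (α 0 * ‖x 0‖) ^ 2 + μ 1 * (α 1 * ‖x 1‖) ^ 2 + μ 2 * (α 2 * ‖x 2‖) ^ 2 := by
    refine h2.trans (le_of_eq ?_)
    simp only [Prod.fst_add, Prod.snd_add, Prod.smul_fst, Prod.smul_snd, inner_add_left,
      inner_add_right, inner_smul_left, inner_smul_right, conj_trivial,
      real_inner_self_eq_norm_sq, ho 0 1 (by decide), ho 0 2 (by decide), ho 1 0 (by decide),
      ho 1 2 (by decide), ho 2 0 (by decide), ho 2 1 (by decide)]
    ring
  have hle : ∀ i, μ i * (α i * ‖x i‖) ^ 2 ≤ 0 := fun i =>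
    mul_nonpos_of_nonpos_of_nonneg (hμ i).le (sq_nonneg _)
  refine hα0 (funext fun i => ?_)
  have hz : μ i * (α i * ‖x i‖) ^ 2 = 0 := by
    have h0 := hle 0
    have h1 := hle 1
    have h2 := hle 2
    fin_cases i
    · change μ 0 * (α 0 * ‖x 0‖) ^ 2 = 0
      linarith
    · change μ 1 * (α 1 * ‖x 1‖) ^ 2 = 0
      linarith
    · change μ 2 * (α 2 * ‖x 2‖) ^ 2 = 0
      linarith
  have := (mul_eq_zero.1 hz).resolve_left (hμ i).ne
  exact (mul_eq_zero.1 (pow_eq_zero_iff two_ne_zero |>.1 this)).resolve_right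
    (norm_ne_zero_iff.2 (hx0 i))

theorem eigenspace_ne_bot_of_jost {σ κ : ℝ} (ha : 0 < a) (hN : 1 < N) (hκ : N - 1 ≤ κ)
    (hω : ω = a ^ 2 * (N - 1) ^ 2)
    (hV : ∀ x, ω - V x = wellPotential a b N (N * (N + 1)) x)
    (h0 : σ * jost N κ b = jost N κ b)
    (hjump : (1 + σ) * (a * jostDeriv N κ b) = -γ * jost N κ b) :
    eigenspace (formOperator ω γ V) (ω - a ^ 2 * κ ^ 2) ≠ ⊥ := by
  obtain ⟨C, hC⟩ := exists_jost_le hN hκ b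
  have hC0 : 0 ≤ C := by
    have := (abs_nonneg _).trans (hC b le_rfl).1
    exact nonneg_of_mul_nonneg_left this (Real.exp_pos _)
  have haff : ∀ x : ℝ, HasDerivAt (fun x => a * x + b) a x := fun x => by
    simpa using ((hasDerivAt_id x).const_mul a).add_const b
  have hmem : ∀ x : ℝ, 0 ≤ x → b ≤ a * x + b := fun x hx => by
    have := mul_nonneg ha.le hx
    linarith
  have hexp : ∀ x : ℝ, Real.exp (-κ * (a * x + b)) =
      Real.exp (-κ * b) * Real.exp (-(κ * a) * x) := fun x => by
    rw [← Real.exp_add]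
    ring_nf
  refine exists_mem_graph_of_halfLine (σ := σ) (w := fun x => jost N κ (a * x + b))
    (w' := fun x => a * jostDeriv N κ (a * x + b)) (k := κ * a)
    (C := (1 + a) * (C * Real.exp (-κ * b)))
    (q := fun x => a ^ 2 * (κ ^ 2 - N * (N + 1) * (1 - Real.tanh (a * x + b) ^ 2)))
    (fun x => ?_) (fun x => ?_) ?_ (mul_pos (by linarith) ha) (fun x hx => ?_) (fun x hx => ?_)
    (by simpa using h0) (by simpa using hjump) (fun x => ?_) ?_
  · refine ((hasDerivAt_jost hN hκ (a * x + b)).comp x (haff x)).congr_deriv ?_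
    ring
  · refine (((hasDerivAt_jostDeriv hN hκ (a * x + b)).comp x (haff x)).const_mul a).congr_deriv ?_
    ring
  · have := continuous_tanh
    fun_prop
  · refine (hC _ (hmem x hx)).1.trans ?_
    rw [hexp, ← mul_assoc]
    refine mul_le_mul_of_nonneg_right ?_ (Real.exp_pos _).le
    nlinarith [mul_nonneg hC0 (Real.exp_pos (-κ * b)).le]
  · rw [abs_mul, abs_of_pos ha]
    refine (mul_le_mul_of_nonneg_left (hC _ (hmem x hx)).2 ha.le).trans ?_
    rw [hexp, ← mul_assoc, ← mul_assoc]
    refine mul_le_mul_of_nonneg_right ?_ (Real.exp_pos _).le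
    nlinarith [mul_nonneg hC0 (Real.exp_pos (-κ * b)).le]
  · rw [hV, wellPotential, hω]
    ring
  · obtain ⟨y, hy, hne⟩ := exists_jost_ne_zero hN hκ b
    refine ⟨(y - b) / a, div_pos (by linarith) ha, ?_⟩
    rwa [mul_div_cancel₀ _ ha.ne', sub_add_cancel]

theorem negEigenvalues_encard_of_nodes (ha : 0 < a) (hb : b < 0) (hN : 1 < N)
    (ht : Real.tanh b < 0) (hω : ω = a ^ 2 * (N - 1) ^ 2)
    (hγ : γ = 2 * a * (N - 1) * Real.tanh b)
    (hV : ∀ x, ω - V x = wellPotential a b N (N * (N + 1)) x) :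
    (negEigenvalues (formOperator ω γ V)).encard = 2 := by
  obtain ⟨κ₁, h₁, h₁', e₁⟩ := exists_jost_eq_zero hN ht
  obtain ⟨κ₂, h₂, e₂⟩ := exists_jost_robin hN ht
  have neg : ∀ κ, N - 1 < κ → ω - a ^ 2 * κ ^ 2 < 0 := by
    intro κ hκ
    have h : (N - 1) ^ 2 < κ ^ 2 := pow_lt_pow_left₀ hκ (by linarith) two_ne_zero
    have := mul_lt_mul_of_pos_left h (pow_pos ha 2)
    linarith
  have m₁ := eigenspace_ne_bot_of_jost (γ := γ) (σ := -1) (κ := κ₁) ha hN h₁.le hω hV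
    (by rw [e₁, mul_zero]) (by rw [e₁]; ring)
  have m₂ := eigenspace_ne_bot_of_jost (γ := γ) (σ := 1) (κ := κ₂) ha hN (by linarith) hω hV
    (one_mul _) (by rw [hγ]; linear_combination 2 * a * e₂)
  -- The value N separates the two roots: κ₁ < N < κ₂.
  have hne : ω - a ^ 2 * κ₁ ^ 2 ≠ ω - a ^ 2 * κ₂ ^ 2 := by
    have h : κ₁ ^ 2 < κ₂ ^ 2 := pow_lt_pow_left₀ (by linarith) (by linarith) two_ne_zero
    have := mul_lt_mul_of_pos_left h (pow_pos ha 2)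
    intro h
    linarith
  have heq : negEigenvalues (formOperator ω γ V) =
      {ω - a ^ 2 * κ₁ ^ 2, ω - a ^ 2 * κ₂ ^ 2} := by
    refine Subset.antisymm (fun μ hμ => ?_) ?_
    · by_contra hcon
      simp only [mem_insert_iff, mem_singleton_iff, not_or] at hcon
      obtain ⟨i, hi⟩ := eigenspace_eq_bot_of_nodes ha hb hγ hV
        (μ := ![ω - a ^ 2 * κ₁ ^ 2, ω - a ^ 2 * κ₂ ^ 2, μ])
        (by
          intro i
          fin_cases i
          · exact neg κ₁ h₁
          · exact neg κ₂ (by linarith)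
          · exact hμ.1)
        (by
          intro i j hij
          fin_cases i <;> fin_cases j <;> simp_all [eq_comm])
      fin_cases i
      · exact m₁ hi
      · exact m₂ hi
      · exact hμ.2 hi
    · rintro μ (rfl | rfl)
      · exact ⟨neg κ₁ h₁, m₁⟩
      · exact ⟨neg κ₂ (by linarith), m₂⟩
  rw [heq, encard_pair hne]

end Spectrum

/-! ### Splitting the complex operator into real and imaginary parts -/

section ComplexOperator

theorem coeFn_reL (u : L2C) : reL u =ᵐ[volume] fun x => (u x).re :=
  Complex.reCLM.coeFn_compLp u

theorem coeFn_imL (u : L2C) : imL u =ᵐ[volume] fun x => (u x).im :=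
  Complex.imCLM.coeFn_compLp u

theorem coeFn_ofRealL (u : L2R) : ofRealL u =ᵐ[volume] fun x => (u x : ℂ) :=
  Complex.ofRealCLM.coeFn_compLp u

theorem coeFn_ofImL (u : L2R) : ofImL u =ᵐ[volume] fun x => Complex.I * (u x : ℂ) :=
  (Complex.I • Complex.ofRealCLM : ℝ →L[ℝ] ℂ).coeFn_compLp u

theorem reL_ofRealL (u : L2R) : reL (ofRealL u) = u := by
  refine Lp.ext ?_
  filter_upwards [coeFn_reL (ofRealL u), coeFn_ofRealL u] with x h1 h2
  rw [h1, h2, Complex.ofReal_re]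

theorem imL_ofRealL (u : L2R) : imL (ofRealL u) = 0 := by
  refine Lp.ext ?_
  filter_upwards [coeFn_imL (ofRealL u), coeFn_ofRealL u, Lp.coeFn_zero ℝ 2 volume] with x h1 h2 h3
  rw [h1, h2, h3, Complex.ofReal_im, Pi.zero_apply]

theorem reL_ofImL (u : L2R) : reL (ofImL u) = 0 := by
  refine Lp.ext ?_
  filter_upwards [coeFn_reL (ofImL u), coeFn_ofImL u, Lp.coeFn_zero ℝ 2 volume] with x h1 h2 h3
  rw [h1, h2, h3, Pi.zero_apply]
  simp

theorem imL_ofImL (u : L2R) : imL (ofImL u) = u := by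
  refine Lp.ext ?_
  filter_upwards [coeFn_imL (ofImL u), coeFn_ofImL u] with x h1 h2
  rw [h1, h2]
  simp

theorem ofRealL_add_ofImL (u : L2C) : ofRealL (reL u) + ofImL (imL u) = u := by
  refine Lp.ext ?_
  filter_upwards [Lp.coeFn_add (ofRealL (reL u)) (ofImL (imL u)), coeFn_ofRealL (reL u),
    coeFn_ofImL (imL u), coeFn_reL u, coeFn_imL u] with x h h1 h2 h3 h4
  rw [h, Pi.add_apply, h1, h2, h3, h4, mul_comm, Complex.re_add_im]

variable {p : ℝ} (hp : 1 < p) (ω γ μ : ℝ)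

theorem mem_eigenspace_H {u : L2C} : u ∈ eigenspace (H hp ω γ) μ ↔
    reL u ∈ eigenspace (L1 hp ω γ) μ ∧ imL u ∈ eigenspace (L2 hp ω γ) μ := by
  constructor
  · rintro ⟨h, hu⟩
    change ofRealL (L1 hp ω γ ⟨reL u, h.1⟩) + ofImL (L2 hp ω γ ⟨imL u, h.2⟩) = μ • u at hu
    refine ⟨⟨h.1, ?_⟩, ⟨h.2, ?_⟩⟩
    · have := congrArg reL hu
      rwa [map_add, reL_ofRealL, reL_ofImL, add_zero, map_smul] at this
    · have := congrArg imL hu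
      rwa [map_add, imL_ofRealL, imL_ofImL, zero_add, map_smul] at this
  · rintro ⟨⟨h1, e1⟩, ⟨h2, e2⟩⟩
    refine ⟨⟨h1, h2⟩, ?_⟩
    change ofRealL (L1 hp ω γ ⟨reL u, h1⟩) + ofImL (L2 hp ω γ ⟨imL u, h2⟩) = μ • u
    rw [e1, e2, map_smul, map_smul, ← smul_add, ofRealL_add_ofImL]

theorem eigenspace_H_eq_map (h : eigenspace (L2 hp ω γ) μ = ⊥) :
    eigenspace (H hp ω γ) μ = (eigenspace (L1 hp ω γ) μ).map ofRealL := by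
  ext u
  rw [mem_eigenspace_H, h, Submodule.mem_bot, Submodule.mem_map]
  constructor
  · rintro ⟨h1, h2⟩
    refine ⟨reL u, h1, ?_⟩
    conv_rhs => rw [← ofRealL_add_ofImL u, h2, map_zero, add_zero]
  · rintro ⟨x, hx, rfl⟩
    exact ⟨by rwa [reL_ofRealL], imL_ofRealL x⟩

theorem ofRealL_injective : Function.Injective ofRealL :=
  Function.LeftInverse.injective reL_ofRealL

end ComplexOperator

/-! ### Parameters of the profile and conclusion -/

/-- The scaled parameters of the profile: `sech` argument `a|x| + b` and `N = (p+1)/(p-1)`. -/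
theorem exists_profile_parameters {p : ℝ} (hp : 1 < p) {ω γ : ℝ} (hγ : γ < 0)
    (hω : γ ^ 2 / 4 < ω) :
    ∃ a b N : ℝ, 0 < a ∧ b < 0 ∧ 1 < N ∧ Real.tanh b < 0 ∧ ω = a ^ 2 * (N - 1) ^ 2 ∧
      γ = 2 * a * (N - 1) * Real.tanh b ∧
      (∀ x, ω - potential p hp ω γ x = wellPotential a b N (N * (N + 1)) x) ∧
      (∀ x, ω - potential 1 hp ω γ x = wellPotential a b N (N * (N - 1)) x) := by
  have hω0 : 0 < ω := lt_of_le_of_lt (by positivity) hω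
  have hs : 0 < √ω := Real.sqrt_pos.2 hω0
  have hsq : √ω ^ 2 = ω := Real.sq_sqrt hω0.le
  have hp1 : 0 < p - 1 := by linarith
  -- The condition ω > γ²/4 keeps the argument of artanh above -1, and γ < 0 makes b negative, so
  -- that the nodes ±b/a exist.
  have hmem : γ / (2 * √ω) ∈ Ioo (-1 : ℝ) 0 := by
    refine ⟨?_, div_neg_of_neg_of_pos hγ (by positivity)⟩
    rw [lt_div_iff₀ (by positivity)]
    nlinarith
  have htanh : Real.tanh (Real.artanh (γ / (2 * √ω))) = γ / (2 * √ω) :=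
    Real.tanh_artanh ⟨hmem.1, hmem.2.trans one_pos⟩
  have hN : (p + 1) / (p - 1) - 1 = 2 / (p - 1) := by
    field_simp
    ring
  have hpot : ∀ c x, potential c hp ω γ x = c * ((p + 1) * ω / 2 *
      (1 - Real.tanh ((p - 1) * √ω / 2 * |x| + Real.artanh (γ / (2 * √ω))) ^ 2)) := by
    intro c x
    change c * phi p ω γ x ^ (p - 1) = _
    rw [phi, ← Real.rpow_mul (by positivity), one_div_mul_cancel hp1.ne', Real.rpow_one,
      one_div_cosh_sq]
  refine ⟨(p - 1) * √ω / 2, Real.artanh (γ / (2 * √ω)), (p + 1) / (p - 1), by positivity,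
    Real.artanh_neg hmem, by rw [one_lt_div hp1]; linarith, by rw [htanh]; exact hmem.2, ?_, ?_,
    fun x => ?_, fun x => ?_⟩
  · rw [hN]
    field_simp
    linarith
  · rw [hN, htanh]
    field_simp
  · rw [hpot, wellPotential, hN]
    generalize Real.tanh _ = t
    field_simp
    rw [hsq]
    ring
  · rw [hpot, wellPotential, hN]
    generalize Real.tanh _ = t
    field_simp
    rw [hsq]
    ring

end DeltaNLS

end

theorem lemma4 {p : ℝ} (hp : 1 < p) (ω γ : ℝ) (hγ : γ < 0) (hω : γ ^ 2 / 4 < ω) :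
    ((DeltaNLS.negEigenvalues (DeltaNLS.L1 hp ω γ)).encard = 2 ∧
      ∀ μ ∈ DeltaNLS.negEigenvalues (DeltaNLS.L1 hp ω γ),
        Module.finrank ℝ (DeltaNLS.eigenspace (DeltaNLS.L1 hp ω γ) μ) = 1) ∧
    ((DeltaNLS.negEigenvalues (DeltaNLS.H hp ω γ)).encard = 2 ∧
      ∀ μ ∈ DeltaNLS.negEigenvalues (DeltaNLS.H hp ω γ),
        Module.finrank ℝ (DeltaNLS.eigenspace (DeltaNLS.H hp ω γ) μ) = 1) := by
  obtain ⟨a, b, N, ha, hb, hN, ht, hωa, hγa, hV₁, hV₂⟩ :=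
    DeltaNLS.exists_profile_parameters hp hγ hω
  have hcard : (DeltaNLS.negEigenvalues (DeltaNLS.L1 hp ω γ)).encard = 2 :=
    DeltaNLS.negEigenvalues_encard_of_nodes ha hb hN ht hωa hγa hV₁
  have hsimple : ∀ μ ∈ DeltaNLS.negEigenvalues (DeltaNLS.L1 hp ω γ),
      Module.finrank ℝ (DeltaNLS.eigenspace (DeltaNLS.L1 hp ω γ) μ) = 1 := fun μ hμ =>
    DeltaNLS.finrank_eigenspace_formOperator hμ.2
  -- Below zero the imaginary component must vanish, so only real eigenfunctions survive.
  have hmap : ∀ μ < 0, DeltaNLS.eigenspace (DeltaNLS.H hp ω γ) μ =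
      (DeltaNLS.eigenspace (DeltaNLS.L1 hp ω γ) μ).map DeltaNLS.ofRealL := fun μ hμ =>
    DeltaNLS.eigenspace_H_eq_map hp ω γ μ (DeltaNLS.eigenspace_eq_bot_of_ground hγa hV₂ hμ)
  have hneg : DeltaNLS.negEigenvalues (DeltaNLS.H hp ω γ) =
      DeltaNLS.negEigenvalues (DeltaNLS.L1 hp ω γ) := by
    ext μ
    refine and_congr_right fun hμ => not_congr ?_
    rw [hmap μ hμ, ← Submodule.map_bot DeltaNLS.ofRealL]
    exact (Submodule.map_injective_of_injective DeltaNLS.ofRealL_injective).eq_iff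
  refine ⟨⟨hcard, hsimple⟩, by rw [hneg, hcard], fun μ hμ => ?_⟩
  rw [hneg] at hμ
  rw [hmap μ hμ.1, ← hsimple μ hμ]
  exact (Submodule.equivMapOfInjective _ DeltaNLS.ofRealL_injective _).finrank_eq.symm
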